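/- Let $G_0$ be a finite union of smooth domains in $\mathbb R^2$ whose closures are pairwise disjoint and contained in the open unit square $\square=(0,1)^2$. Put $Y=\overline{\square}\setminus\overline{G_0}$, let $|Y|$ be its Lebesgue measure and $\langle f\rangle_Y=|Y|^{-1}\int_Y f\,d\xi$, and assume that $Y$ is symmetric with respect to the lines $\xi_1=\frac12$ and $\xi_2=\frac12$. Let $\nu=(\nu_1,\nu_2)$ be the unit normal to $\partial G_0$ (and, extended periodically, to its integer translates) that is external to $Y$. Let $N_1$ be a solution of the cell problem, that is, a function on the union of the integer translates of $\overline{\square}\setminus G_0$, smooth up to the boundaries of the holes, $1$-periodic in $\xi_1$ and $\xi_2$, with $$\Delta_\xi N_1=0\ \text{ in } Y,\qquad \partial_\nu N_1=-\nu_1\ \text{ on }\partial G_0,\qquad \langle N_1\rangle_Y=0,$$ and let $h_{11}=\langle 1+\partial_{\xi_1}N_1\rangle_Y$ and $\gamma=\{\xi:\ \xi_1=0,\ 0<\xi_2<1\}$. Call $J\in\mathbb R$ a flux constant if for some $q\in\mathbb R$ the inner-layer problem has a solution: there are functions $B^-$ on $\{\xi_1\le 0\}$ and $B^+$ on the part of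 the periodically perforated plane in $\{\xi_1\ge 0\}$, smooth up to the boundary and $1$-periodic in $\xi_2$, such that $\Delta_\xi B^\pm=0$ in the interior, $\partial_\nu B^+=0$ on the boundaries of the holes, $B^\pm(\xi)\to0$ as $\xi_1\to\pm\infty$ uniformly in $\xi_2$, and on $\gamma$ $$B^+-B^-=q,\qquad \partial_{\xi_1}B^+-\partial_{\xi_1}B^-=-(\partial_{\xi_1}N_1+1)+J .$$ Then every flux constant is equal to $$J_1:=\int_\gamma(\partial_{\xi_1}N_1+1)\big|_{\xi_1=0}\,d\xi_2 ,\qquad\text{and}\qquad J_1=|Y|\,h_{11}.$$ Hence, for every $d>0$ and all functions $v_0^-,v_0^+$, the transmission condition $\partial_{x_1}v_0^-=J_1\,\partial_{x_1}v_0^+$ on $\{x_1=0,\ 0<x_2<d\}$ (with the derivatives taken from the left and from the right, respectively, and required to exist) is equivalent to the homogenized coupling condition $\partial_{x_1}v_0^-=|Y|\,h_{11}\,\partial_{x_1}v_0^+$ there. -/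

import Mathlib

open MeasureTheory Set
open scoped ContDiff Gradient Laplacian

noncomputable section

/-- The Euclidean plane. The coordinates `ξ₁, ξ₂` of a point `ξ` are `ξ 0` and `ξ 1`. -/
abbrev Plane : Type := EuclideanSpace ℝ (Fin 2)

/-- The integer vector `k`, as a point of the plane. -/
def latticePoint (k : Fin 2 → ℤ) : Plane := WithLp.toLp 2 fun i => (k i : ℝ)

/-- The open unit square. -/
def openSquare : Set Plane := {ξ | ∀ i, ξ i ∈ Ioo (0 : ℝ) 1}

/-- The closed unit square. -/
def closedSquare : Set Plane := {ξ | ∀ i, ξ i ∈ Icc (0 : ℝ) 1}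

/-- `φ` is a smooth defining function of `D` near the boundary point `x`:
near `x` the set `D` is `{φ < 0}`, and `∇φ(x) ≠ 0`. -/
structure IsLocalDefiningFunction (D : Set Plane) (x : Plane) (φ : Plane → ℝ) : Prop where
  smooth : ContDiff ℝ ∞ φ
  zero : φ x = 0
  gradient_ne : ∇ φ x ≠ 0
  mem_iff : ∀ᶠ y in nhds x, (y ∈ D ↔ φ y < 0)

/-- A smooth domain: nonempty, open, connected, with smooth boundary. -/
structure IsSmoothDomain (D : Set Plane) : Prop where
  isOpen : IsOpen D
  isConnected : IsConnected D
  smooth_boundary : ∀ x ∈ frontier D, ∃ φ, IsLocalDefiningFunction D x φ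

/-- `ν` is the unit normal at `x ∈ ∂G₀` that points into `G₀`, i.e. out of the perforated
region. -/
def IsUnitNormalInto (G₀ : Set Plane) (x ν : Plane) : Prop :=
  ∃ φ, IsLocalDefiningFunction G₀ x φ ∧ ν = -(‖∇ φ x‖⁻¹ • ∇ φ x)

/-- The periodicity cell `Y`: the closed unit square without the closure of the holes. -/
def cellY (G₀ : Set Plane) : Set Plane := closedSquare \ closure G₀

/-- Reflection with respect to the line `ξ_l = 1/2`. -/
def midReflect (l : Fin 2) (ξ : Plane) : Plane :=
  WithLp.toLp 2 (Function.update ξ.ofLp l (1 - ξ l))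

/-- The holes `G₀`: a finite union of smooth domains that do not meet or touch each other and
whose closures lie in the open unit square, such that `Y` is symmetric with respect to the lines
`ξ₁ = 1/2` and `ξ₂ = 1/2`. -/
def IsHoleSet (G₀ : Set Plane) : Prop :=
  (∃ (n : ℕ) (G : Fin n → Set Plane),
    G₀ = (⋃ i, G i) ∧
    (∀ i, IsSmoothDomain (G i)) ∧
    (∀ i, closure (G i) ⊆ openSquare) ∧
    Pairwise fun i j => Disjoint (closure (G i)) (closure (G j))) ∧
  ∀ l, ∀ ξ ∈ cellY G₀, midReflect l ξ ∈ cellY G₀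

/-- The periodically perforated plane with the boundaries of the holes included (a closed set). -/
def perfPlane (G₀ : Set Plane) : Set Plane := {ξ | ∀ k, ξ - latticePoint k ∉ G₀}

/-- The periodically perforated plane without the boundaries of the holes: the union of all integer
translates of `Y` (an open set). -/
def perfPlaneInt (G₀ : Set Plane) : Set Plane := {ξ | ∀ k, ξ - latticePoint k ∉ closure G₀}

/-- The partial derivative `∂_{ξ_{i+1}} f (ξ)` of a function on `s`; at points of `s` on the
boundary it is the boundary value. -/
def partialIn (s : Set Plane) (f : Plane → ℝ) (i : Fin 2) (ξ : Plane) : ℝ :=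
  fderivWithin ℝ f s ξ (EuclideanSpace.single i 1)

/-- `N` is a solution `N₁` of the first cell problem: smooth up to the boundaries of the holes and
`1`-periodic in both variables (so that it belongs to `H¹_per(Y)`), with `Δ N = 0` in `Y`,
`∂_ν N = -ν₁` on `∂G₀`, and mean value zero over `Y`. -/
structure IsCellSolution (G₀ : Set Plane) (N : Plane → ℝ) : Prop where
  smooth : ContDiffOn ℝ ∞ N (perfPlane G₀)
  periodic : ∀ k, ∀ ξ ∈ perfPlane G₀, N (ξ + latticePoint k) = N ξ
  laplace : ∀ ξ ∈ perfPlaneInt G₀, Δ N ξ = 0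
  neumann : ∀ ξ ∈ frontier G₀, ∀ ν, IsUnitNormalInto G₀ ξ ν →
    fderivWithin ℝ N (perfPlane G₀) ξ ν = -(ν 0)
  mean_zero : ⨍ ξ in cellY G₀, N ξ = 0

/-- The homogenized coefficient `h₁₁ = ⟨1 + ∂_{ξ₁} N₁⟩_Y`. -/
def h11 (G₀ : Set Plane) (N₁ : Plane → ℝ) : ℝ :=
  ⨍ ξ in cellY G₀, (1 + partialIn (perfPlane G₀) N₁ 0 ξ)

/-- The integral of `∂_{ξ₁} N₁ + 1` over `γ = {ξ₁ = 0, 0 < ξ₂ < 1}`. -/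
def interfaceFlux (G₀ : Set Plane) (N₁ : Plane → ℝ) : ℝ :=
  ∫ t in (0 : ℝ)..1, (partialIn (perfPlane G₀) N₁ 0 !₂[0, t] + 1)

/-- The closed left half-plane (the periodic extension of the semi-strip `Υ⁻`). -/
def leftHalf : Set Plane := {ξ | ξ 0 ≤ 0}

/-- The closed perforated right half-plane (the periodic extension of the perforated semi-strip
`Υ⁺`, with the boundaries of the holes included). -/
def rightHalf (G₀ : Set Plane) : Set Plane := {ξ | 0 ≤ ξ 0 ∧ ξ ∈ perfPlane G₀}

/-- `B⁻ = Bm`, `B⁺ = Bp` solve the inner-layer problem for `B₁` with the constants `J` and `q`: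
both functions are smooth up to the boundary, `1`-periodic in `ξ₂`, harmonic and vanish as
`ξ₁ → ∓∞`; `B⁺` has zero normal derivative on the boundaries of the holes; and across `γ`
the jump of `B` is `q` and the jump of `∂_{ξ₁} B` is `-(∂_{ξ₁} N₁ + 1) + J`. -/
structure IsInnerLayerSolution (G₀ : Set Plane) (N₁ : Plane → ℝ) (J q : ℝ)
    (Bm Bp : Plane → ℝ) : Prop where
  smooth_left : ContDiffOn ℝ ∞ Bm leftHalf
  smooth_right : ContDiffOn ℝ ∞ Bp (rightHalf G₀)
  periodic_left : ∀ ξ ∈ leftHalf, Bm (ξ + latticePoint ![0, 1]) = Bm ξ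
  periodic_right : ∀ ξ ∈ rightHalf G₀, Bp (ξ + latticePoint ![0, 1]) = Bp ξ
  laplace_left : ∀ ξ : Plane, ξ 0 < 0 → Δ Bm ξ = 0
  laplace_right : ∀ ξ ∈ perfPlaneInt G₀, 0 < ξ 0 → Δ Bp ξ = 0
  neumann : ∀ k : Fin 2 → ℤ, 0 ≤ k 0 → ∀ ξ ∈ frontier G₀, ∀ ν, IsUnitNormalInto G₀ ξ ν →
    fderivWithin ℝ Bp (rightHalf G₀) (ξ + latticePoint k) ν = 0
  jump : ∀ t ∈ Ioo (0 : ℝ) 1, Bp !₂[0, t] - Bm !₂[0, t] = q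
  jump_deriv : ∀ t ∈ Ioo (0 : ℝ) 1,
    partialIn (rightHalf G₀) Bp 0 !₂[0, t] - partialIn leftHalf Bm 0 !₂[0, t] =
      -(partialIn (perfPlane G₀) N₁ 0 !₂[0, t] + 1) + J
  decay_left : ∀ ε > 0, ∃ M : ℝ, ∀ ξ ∈ leftHalf, ξ 0 ≤ -M → |Bm ξ| < ε
  decay_right : ∀ ε > 0, ∃ M : ℝ, ∀ ξ ∈ rightHalf G₀, M ≤ ξ 0 → |Bp ξ| < ε

/-- `J` is a flux constant: a constant for which the inner-layer problem for `B₁` is solvable. -/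
def IsFluxConstant (G₀ : Set Plane) (N₁ : Plane → ℝ) (J : ℝ) : Prop :=
  ∃ (q : ℝ) (Bm Bp : Plane → ℝ), IsInnerLayerSolution G₀ N₁ J q Bm Bp

/-- The transmission condition `∂_{x₁} v⁻ = κ ∂_{x₁} v⁺` on `Z = {x₁ = 0, 0 < x₂ < d}`, where the
derivatives of `v⁻` and `v⁺` are taken from the left and from the right (and exist). -/
def TransmissionCondition (d κ : ℝ) (vm vp : Plane → ℝ) : Prop :=
  ∀ t ∈ Ioo 0 d, ∃ a b : ℝ,
    HasDerivWithinAt (fun s : ℝ => vm !₂[s, t]) a (Iic 0) 0 ∧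
    HasDerivWithinAt (fun s : ℝ => vp !₂[s, t]) b (Ici 0) 0 ∧
    a = κ * b

end

/-! The field `∇(N₁ + ξ₁)` is periodic, divergence-free in `Y` and tangential to the holes. Green's
formula on the cell, tested with `1`, shows that its fluxes through the left and right sides agree.
Tested with `ξ₁`, it turns the integral of the first component over `Y` into the flux through the
right side, because the weight is `0` on the left side and periodicity cancels top against bottom.
Together these give `J₁ = |Y| h₁₁` (`IsCellSolution.interfaceFlux_eq`).

For a flux constant `J`, integrating the jump of `∂_{ξ₁} B` over `γ` gives `J = J₁` plus the flux of
`B⁺` minus that of `B⁻`, so both fluxes must vanish. For a harmonic function periodic in `ξ₂` on a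
strip without holes, the difference of the vertical means is the flux times the width
(`flux_identity_strip`). On the left the means stay bounded while the width is arbitrary. On the
right the flux is the same through every line `ξ₁ = n`, and a thin strip just to the right of that
line meets no hole; there the means tend to `0` while the width is fixed. Only the decay of `B±` is
used, never that of their gradients.

The analytic core is `integral_cellY_gradDot`, Green's formula on the perforated cell. The
divergence theorem is applied only on rectangles. Near a hole with defining function `φ` the test
function is multiplied by `η((n+1)φ)`, which vanishes near the hole. The error contains `(n+1)
η'((n+1)φ) (∇φ·f)`; tangency gives `|∇φ·f| ≤ Cφ`, so this is bounded uniformly in `n`, it tends to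
`0` pointwise, and dominated convergence removes it. A partition of unity makes the argument global.
-/

open scoped Manifold

noncomputable section

/-! ### Rectangles and the divergence theorem on them -/

/-- The rectangle `[a, b] × [0, 1]`. -/
def periodBox (a b : ℝ) : Set Plane := {ξ | ξ 0 ∈ Icc a b ∧ ξ 1 ∈ Icc (0 : ℝ) 1}

/-- The linear identification of `ℝ × ℝ` with the Euclidean plane. -/
def prodPlane : (ℝ × ℝ) ≃L[ℝ] Plane :=
  (ContinuousLinearEquiv.finTwoArrow ℝ ℝ).symm.trans (EuclideanSpace.equiv (Fin 2) ℝ).symm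

lemma prodPlane_apply (p : ℝ × ℝ) : prodPlane p = !₂[p.1, p.2] := by
  ext i; fin_cases i <;> rfl

lemma prodPlane_zero (p : ℝ × ℝ) : prodPlane p 0 = p.1 := rfl
lemma prodPlane_one (p : ℝ × ℝ) : prodPlane p 1 = p.2 := rfl

lemma measurePreserving_prodPlane : MeasurePreserving prodPlane := by
  have := (PiLp.volume_preserving_toLp (Fin 2)).comp (volume_preserving_finTwoArrow ℝ).symm
  exact this

lemma continuous_vec_right (s : ℝ) : Continuous fun t : ℝ => (!₂[s, t] : Plane) := by
  have : (fun t : ℝ => (!₂[s, t] : Plane)) = fun t => prodPlane (s, t) := by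
    funext t; rw [prodPlane_apply]
  rw [this]; fun_prop

lemma closedSquare_eq_periodBox : closedSquare = periodBox 0 1 := by
  ext ξ; simp only [closedSquare, periodBox, mem_ofPred_eq, Fin.forall_fin_two]

lemma convex_periodBox (a b : ℝ) : Convex ℝ (periodBox a b) := by
  have h : periodBox a b = (EuclideanSpace.proj (𝕜 := ℝ) (0 : Fin 2)) ⁻¹' Icc a b ∩
      (EuclideanSpace.proj (𝕜 := ℝ) (1 : Fin 2)) ⁻¹' Icc 0 1 := rfl
  rw [h]
  exact ((convex_Icc a b).linear_preimage _).inter ((convex_Icc 0 1).linear_preimage _)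

lemma preimage_prodPlane_periodBox (a b : ℝ) :
    prodPlane ⁻¹' periodBox a b = Icc (a, 0) (b, 1) := by
  ext p
  simp only [periodBox, mem_preimage, mem_ofPred_eq, prodPlane_zero, prodPlane_one, mem_Icc,
    Prod.le_def]
  tauto

lemma isCompact_periodBox (a b : ℝ) : IsCompact (periodBox a b) := by
  have := isCompact_Icc (a := ((a, 0) : ℝ × ℝ)) (b := (b, 1))
  rw [← preimage_prodPlane_periodBox] at this
  have := this.image prodPlane.continuous
  rwa [image_preimage_eq _ prodPlane.surjective] at this

lemma isOpen_openBox (a b : ℝ) : IsOpen {ξ : Plane | ξ 0 ∈ Ioo a b ∧ ξ 1 ∈ Ioo (0 : ℝ) 1} := by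
  refine IsOpen.inter ?_ ?_
  · exact isOpen_Ioo.preimage (EuclideanSpace.proj (𝕜 := ℝ) (0 : Fin 2)).continuous
  · exact isOpen_Ioo.preimage (EuclideanSpace.proj (𝕜 := ℝ) (1 : Fin 2)).continuous

lemma openBox_subset (a b : ℝ) :
    {ξ : Plane | ξ 0 ∈ Ioo a b ∧ ξ 1 ∈ Ioo (0 : ℝ) 1} ⊆ periodBox a b :=
  fun _ h => ⟨Ioo_subset_Icc_self h.1, Ioo_subset_Icc_self h.2⟩

lemma periodBox_mem_nhds {a b : ℝ} {ξ : Plane} (h0 : ξ 0 ∈ Ioo a b)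
    (h1 : ξ 1 ∈ Ioo (0 : ℝ) 1) : periodBox a b ∈ nhds ξ :=
  Filter.mem_of_superset ((isOpen_openBox a b).mem_nhds ⟨h0, h1⟩) (openBox_subset a b)

lemma uniqueDiffOn_periodBox {a b : ℝ} (hab : a < b) : UniqueDiffOn ℝ (periodBox a b) := by
  refine uniqueDiffOn_convex (convex_periodBox a b) ⟨!₂[(a + b) / 2, 1 / 2], ?_⟩
  rw [mem_interior_iff_mem_nhds]
  apply periodBox_mem_nhds
  · constructor <;> simp <;> linarith
  · constructor <;> norm_num

lemma partialIn_contDiffOn {s : Set Plane} (hs : UniqueDiffOn ℝ s) {f : Plane → ℝ}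
    {m n : WithTop ℕ∞} (hf : ContDiffOn ℝ n f s) (hmn : m + 1 ≤ n) (i : Fin 2) :
    ContDiffOn ℝ m (partialIn s f i) s :=
  (hf.fderivWithin hs hmn).clm_apply contDiffOn_const

/-- The divergence theorem on a rectangle. -/
lemma integral_divergence_periodBox {a b : ℝ} (hab : a < b) {H : Fin 2 → Plane → ℝ}
    (hH : ∀ i, ContDiffOn ℝ 1 (H i) (periodBox a b)) :
    ∫ ξ in periodBox a b, ∑ i, partialIn (periodBox a b) (H i) i ξ =
      (∫ y in (0 : ℝ)..1, H 0 !₂[b, y]) - (∫ y in (0 : ℝ)..1, H 0 !₂[a, y]) +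
        ((∫ x in a..b, H 1 !₂[x, 1]) - ∫ x in a..b, H 1 !₂[x, 0]) := by
  have hu := uniqueDiffOn_periodBox hab
  have hmaps : MapsTo prodPlane (Icc (a, 0) (b, 1)) (periodBox a b) := by
    rw [← preimage_prodPlane_periodBox]; exact mapsTo_preimage _ _
  have hcomp := fun i => ((hH i).continuousOn.comp prodPlane.continuous.continuousOn hmaps)
  let f' : Fin 2 → ℝ × ℝ → (ℝ × ℝ →L[ℝ] ℝ) := fun i p =>
    (fderivWithin ℝ (H i) (periodBox a b) (prodPlane p)).comp (prodPlane : (ℝ × ℝ) →L[ℝ] Plane)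
  have hder : ∀ i, ∀ p ∈ Ioo a b ×ˢ Ioo (0 : ℝ) 1,
      HasFDerivAt (H i ∘ prodPlane) (f' i p) p := by
    intro i p hp
    have hm : periodBox a b ∈ nhds (prodPlane p) := periodBox_mem_nhds hp.1 hp.2
    have h1 := ((hH i).differentiableOn one_ne_zero _ (mem_of_mem_nhds hm)).hasFDerivWithinAt
    exact (h1.hasFDerivAt hm).comp p prodPlane.hasFDerivAt
  have e0 : prodPlane (1, 0) = EuclideanSpace.single 0 1 := by
    ext i; fin_cases i <;> rfl
  have e1 : prodPlane (0, 1) = EuclideanSpace.single 1 1 := by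
    ext i; fin_cases i <;> rfl
  have hsum : ∀ p, f' 0 p (1, 0) + f' 1 p (0, 1) =
      ∑ i, partialIn (periodBox a b) (H i) i (prodPlane p) := by
    intro p
    simp [f', partialIn, Fin.sum_univ_two, e0, e1]
  have hcont : ContinuousOn (fun ξ => ∑ i, partialIn (periodBox a b) (H i) i ξ)
      (periodBox a b) :=
    continuousOn_finsetSum _ fun i _ => (partialIn_contDiffOn (m := 0) hu (hH i) (by simp)
      i).continuousOn
  have key := integral_divergence_prod_Icc_of_hasFDerivAt_of_le (H 0 ∘ prodPlane)
    (H 1 ∘ prodPlane) (f' 0) (f' 1) (a, 0) (b, 1) (by simp [Prod.le_def, hab.le])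
    (hcomp 0) (hcomp 1) (hder 0) (hder 1) (by
      simp_rw [hsum]
      exact (hcont.comp prodPlane.continuous.continuousOn hmaps).integrableOn_compact
        isCompact_Icc)
  simp_rw [hsum, Function.comp, prodPlane_apply] at key
  rw [← measurePreserving_prodPlane.setIntegral_preimage_emb
    prodPlane.toHomeomorph.measurableEmbedding, preimage_prodPlane_periodBox]
  simp_rw [prodPlane_apply]
  rw [key]; ring

/-! ### Harmonic functions on a rectangle -/

/-- Second-order partial derivatives of a function of the plane and its Laplacian. -/
lemma sum_partial_partial_eq_laplacian {s : Set Plane} {u : Plane → ℝ} {x : Plane}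
    (hs : s ∈ nhds x) (hu : ContDiffOn ℝ 2 u s) :
    ∑ i, fderiv ℝ (partialIn s u i) x (EuclideanSpace.single i 1) = Δ u x := by
  rw [InnerProductSpace.laplacian_eq_iteratedFDeriv_orthonormalBasis u
    (EuclideanSpace.basisFun (Fin 2) ℝ)]
  refine Finset.sum_congr rfl fun i _ => ?_
  have h1 : partialIn s u i =ᶠ[nhds x] fun y => fderiv ℝ u y (EuclideanSpace.single i 1) := by
    filter_upwards [eventually_mem_nhds_iff.2 hs] with y hy
    simp only [partialIn, fderivWithin_of_mem_nhds hy]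
  have h2 : DifferentiableAt ℝ (fderiv ℝ u) x :=
    ((hu.contDiffAt hs).fderiv_right (m := 1) (by norm_num)).differentiableAt one_ne_zero
  rw [h1.fderiv_eq, fderiv_clm_apply h2 (by fun_prop), iteratedFDeriv_two_apply]
  simp

lemma interior_periodBox (a b : ℝ) :
    interior (periodBox a b) = {ξ : Plane | ξ 0 ∈ Ioo a b ∧ ξ 1 ∈ Ioo (0 : ℝ) 1} := by
  have h : periodBox a b = (EuclideanSpace.proj (𝕜 := ℝ) (0 : Fin 2)) ⁻¹' Icc a b ∩
      (EuclideanSpace.proj (𝕜 := ℝ) (1 : Fin 2)) ⁻¹' Icc 0 1 := rfl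
  have ho : ∀ i, IsOpenMap (EuclideanSpace.proj (𝕜 := ℝ) (i : Fin 2)) := fun i =>
    (EuclideanSpace.proj (𝕜 := ℝ) (i : Fin 2)).isOpenMap
      fun r => ⟨EuclideanSpace.single i r, by simp⟩
  have hp : ∀ (i : Fin 2) (t : Set ℝ), interior (EuclideanSpace.proj (𝕜 := ℝ) i ⁻¹' t) =
      EuclideanSpace.proj (𝕜 := ℝ) i ⁻¹' interior t := fun i t =>
    ((ho i).preimage_interior_eq_interior_preimage
      (EuclideanSpace.proj (𝕜 := ℝ) i).continuous t).symm
  rw [h, interior_inter, hp, hp, interior_Icc, interior_Icc]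
  rfl

/-- The frontier of a convex set is null. Integrands need to be identified only in the open
rectangle, where within-derivatives are genuine derivatives. -/
lemma ae_mem_openBox (a b : ℝ) : ∀ᵐ ξ : Plane, ξ ∈ periodBox a b →
    ξ 0 ∈ Ioo a b ∧ ξ 1 ∈ Ioo (0 : ℝ) 1 := by
  have h0 : ∀ᵐ ξ : Plane, ξ ∉ frontier (periodBox a b) :=
    measure_eq_zero_iff_ae_notMem.1 ((convex_periodBox a b).addHaar_frontier volume)
  filter_upwards [h0] with ξ hξ hs
  have : ξ ∈ interior (periodBox a b) := by
    by_contra h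
    exact hξ ⟨subset_closure hs, h⟩
  rwa [interior_periodBox] at this

lemma vertical_mem_periodBox {a b x y : ℝ} (hx : x ∈ Icc a b) (hy : y ∈ Icc (0 : ℝ) 1) :
    (!₂[x, y] : Plane) ∈ periodBox a b := ⟨hx, hy⟩

lemma intervalIntegrable_vertical {a b x : ℝ} (hx : x ∈ Icc a b) {f : Plane → ℝ}
    (hf : ContinuousOn f (periodBox a b)) :
    IntervalIntegrable (fun y => f !₂[x, y]) volume 0 1 := by
  apply ContinuousOn.intervalIntegrable
  rw [uIcc_of_le zero_le_one]
  exact hf.comp (continuous_vec_right x).continuousOn fun y hy => vertical_mem_periodBox hx hy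

/-- A function harmonic in a rectangle and periodic in the second variable: the mean
values over the vertical sides are related with the fluxes through them. -/
lemma flux_identity_periodBox {a b : ℝ} (hab : a < b) {u : Plane → ℝ}
    (hu : ContDiffOn ℝ 2 u (periodBox a b))
    (hΔ : ∀ ξ : Plane, ξ 0 ∈ Ioo a b → ξ 1 ∈ Ioo (0 : ℝ) 1 → Δ u ξ = 0)
    (hper : ∀ x ∈ Icc a b, partialIn (periodBox a b) u 1 !₂[x, 1] =
      partialIn (periodBox a b) u 1 !₂[x, 0]) (c : ℝ) :
    (b - c) * (∫ y in (0 : ℝ)..1, partialIn (periodBox a b) u 0 !₂[b, y])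
      - (a - c) * (∫ y in (0 : ℝ)..1, partialIn (periodBox a b) u 0 !₂[a, y]) =
    (∫ y in (0 : ℝ)..1, u !₂[b, y]) - ∫ y in (0 : ℝ)..1, u !₂[a, y] := by
  set s := periodBox a b with hs
  have hud : UniqueDiffOn ℝ s := uniqueDiffOn_periodBox hab
  have hf : ∀ i, ContDiffOn ℝ 1 (partialIn s u i) s :=
    fun i => partialIn_contDiffOn hud hu (by norm_num) i
  have hu1 : ContDiffOn ℝ 1 u s := hu.of_le (by norm_num)
  have hcoord : ContDiff ℝ 1 fun ξ : Plane => ξ 0 - c :=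
    (EuclideanSpace.proj (𝕜 := ℝ) (0 : Fin 2)).contDiff.sub contDiff_const
  -- The field `(ξ₁ - c)∇u - u e₁` has divergence `(ξ₁ - c)Δu`, since the two terms `∂₁u` cancel.
  -- Choosing `c` as the abscissa of one side removes the flux through that side.
  let H : Fin 2 → Plane → ℝ :=
    ![fun ξ => (ξ 0 - c) * partialIn s u 0 ξ - u ξ, fun ξ => (ξ 0 - c) * partialIn s u 1 ξ]
  have hH : ∀ i, ContDiffOn ℝ 1 (H i) s := by
    intro i
    fin_cases i
    · exact (hcoord.contDiffOn.mul (hf 0)).sub hu1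
    · exact hcoord.contDiffOn.mul (hf 1)
  have key := integral_divergence_periodBox hab hH
  have hint : ∀ᵐ ξ : Plane, ξ ∈ periodBox a b →
      ξ 0 ∈ Ioo a b ∧ ξ 1 ∈ Ioo (0 : ℝ) 1 := ae_mem_openBox a b
  have hzero : ∫ ξ in periodBox a b, ∑ i, partialIn (periodBox a b) (H i) i ξ = 0 := by
    apply setIntegral_eq_zero_of_ae_eq_zero
    filter_upwards [hint] with ξ hξ hξs
    have hξo := hξ hξs
    have hm : s ∈ nhds ξ := periodBox_mem_nhds hξo.1 hξo.2
    have hL := sum_partial_partial_eq_laplacian hm hu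
    rw [hΔ ξ hξo.1 hξo.2, Fin.sum_univ_two] at hL
    have d0 := fun i => ((hf i).contDiffAt hm).differentiableAt one_ne_zero
    have d1 := (hu1.contDiffAt hm).differentiableAt one_ne_zero
    have d2 : HasFDerivAt (fun ξ : Plane => ξ 0 - c)
      (EuclideanSpace.proj (𝕜 := ℝ) (0 : Fin 2)) ξ :=
      (EuclideanSpace.proj (𝕜 := ℝ) (0 : Fin 2)).hasFDerivAt.sub_const c
    have k0 := ((d2.mul (d0 0).hasFDerivAt).sub d1.hasFDerivAt).fderiv
    have k1 := (d2.mul (d0 1).hasFDerivAt).fderiv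
    have k2 : partialIn s u 0 ξ = fderiv ℝ u ξ (EuclideanSpace.single 0 1) := by
      simp only [partialIn, fderivWithin_of_mem_nhds hm]
    rw [Fin.sum_univ_two]
    change partialIn s (H 0) 0 ξ + partialIn s (H 1) 1 ξ = 0
    rw [partialIn, partialIn, fderivWithin_of_mem_nhds hm, fderivWithin_of_mem_nhds hm]
    change fderiv ℝ (fun ξ => (ξ 0 - c) * partialIn s u 0 ξ - u ξ) ξ _ +
      fderiv ℝ (fun ξ => (ξ 0 - c) * partialIn s u 1 ξ) ξ _ = 0
    have k0' : fderiv ℝ (fun ξ => (ξ 0 - c) * partialIn s u 0 ξ - u ξ) ξ = _ := k0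
    have k1' : fderiv ℝ (fun ξ => (ξ 0 - c) * partialIn s u 1 ξ) ξ = _ := k1
    rw [k0', k1']
    simp [k2]
    linear_combination (ξ 0 - c) * hL
  have hI := fun x (hx : x ∈ Icc a b) => intervalIntegrable_vertical hx (hf 0).continuousOn
  have hJ := fun x (hx : x ∈ Icc a b) => intervalIntegrable_vertical hx hu.continuousOn
  have hvert : ∀ x ∈ Icc a b, ∫ y in (0 : ℝ)..1, H 0 !₂[x, y] =
      (x - c) * (∫ y in (0 : ℝ)..1, partialIn s u 0 !₂[x, y]) -
        ∫ y in (0 : ℝ)..1, u !₂[x, y] := by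
    intro x hx
    rw [← intervalIntegral.integral_const_mul,
      ← intervalIntegral.integral_sub ((hI x hx).const_mul _) (hJ x hx)]
    rfl
  have hhor : ∫ x in a..b, H 1 !₂[x, 1] = ∫ x in a..b, H 1 !₂[x, 0] := by
    apply intervalIntegral.integral_congr
    intro x hx
    rw [uIcc_of_le hab.le] at hx
    change (x - c) * partialIn s u 1 !₂[x, 1] = (x - c) * partialIn s u 1 !₂[x, 0]
    rw [hper x hx]
  rw [hzero, hvert b ⟨hab.le, le_rfl⟩, hvert a ⟨le_rfl, hab.le⟩, hhor] at key
  linarith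

/-! ### Tangential divergence-free fields near a regular boundary -/

/-- The divergence-type sum `∑ ∂ᵢψ fᵢ`. -/
def gradDot (ψ : Plane → ℝ) (f : Fin 2 → Plane → ℝ) (x : Plane) : ℝ :=
  ∑ i, fderiv ℝ ψ x (EuclideanSpace.single i 1) * f i x

/-- The divergence of a planar vector field. -/
def planeDiv (f : Fin 2 → Plane → ℝ) (x : Plane) : ℝ :=
  ∑ i, fderiv ℝ (f i) x (EuclideanSpace.single i 1)

/-- Vanishing up to `1`, rather than up to `0`, makes `η((n+1)φ)` zero in a neighbourhood of `{φ ≤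
0}`. The bound on `t η'(t)` absorbs the factor `n + 1` produced by differentiation. -/
lemma exists_cutoff : ∃ η : ℝ → ℝ, ContDiff ℝ ∞ η ∧ (∀ t ≤ 1, η t = 0) ∧ (∀ t, 2 ≤ t → η t = 1) ∧
    (∀ t, |η t| ≤ 1) ∧ (∀ t < 1, deriv η t = 0) ∧ (∀ t, 2 < t → deriv η t = 0) ∧
    ∃ K, ∀ t, |t * deriv η t| ≤ K := by
  have hs : ContDiff ℝ ∞ fun t : ℝ => Real.smoothTransition (t - 1) :=
    Real.smoothTransition.contDiff.comp (contDiff_id.sub contDiff_const)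
  have h0 : ∀ t : ℝ, t ≤ 1 → Real.smoothTransition (t - 1) = 0 := fun t ht =>
    Real.smoothTransition.zero_of_nonpos (by linarith)
  have h1 : ∀ t : ℝ, 2 ≤ t → Real.smoothTransition (t - 1) = 1 := fun t ht =>
    Real.smoothTransition.one_of_one_le (by linarith)
  have d0 : ∀ t : ℝ, t < 1 → deriv (fun t : ℝ => Real.smoothTransition (t - 1)) t = 0 := by
    intro t ht
    have : (fun t : ℝ => Real.smoothTransition (t - 1)) =ᶠ[nhds t] fun _ => 0 := by
      filter_upwards [Iio_mem_nhds ht] with s hs using h0 s (le_of_lt hs)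
    rw [this.deriv_eq, deriv_const]
  have d1 : ∀ t : ℝ, 2 < t → deriv (fun t : ℝ => Real.smoothTransition (t - 1)) t = 0 := by
    intro t ht
    have : (fun t : ℝ => Real.smoothTransition (t - 1)) =ᶠ[nhds t] fun _ => 1 := by
      filter_upwards [Ioi_mem_nhds ht] with s hs using h1 s (le_of_lt hs)
    rw [this.deriv_eq, deriv_const]
  refine ⟨_, hs, h0, h1, fun t => ?_, d0, d1, ?_⟩
  · rw [abs_of_nonneg (Real.smoothTransition.nonneg _)]
    exact Real.smoothTransition.le_one _
  · have hc : Continuous fun t => t * deriv (fun t : ℝ => Real.smoothTransition (t - 1)) t :=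
      continuous_id.mul (hs.continuous_deriv (by simp))
    obtain ⟨K, hK⟩ := isCompact_Icc.exists_bound_of_continuousOn
      (hc.continuousOn (s := Icc (1 : ℝ) 2))
    refine ⟨max K 0, fun t => ?_⟩
    rcases lt_or_ge t 1 with h | h
    · simp [d0 t h]
    rcases lt_or_ge 2 t with h' | h'
    · simp [d1 t h']
    · exact (hK t ⟨h, h'⟩).trans (le_max_left _ _)

/-- Integration by parts against the constant function `1`. -/
lemma integral_fderiv_eq_zero {h : Plane → ℝ} (hc : ContDiff ℝ 1 h) (hs : HasCompactSupport h)
    (v : Plane) : ∫ x, fderiv ℝ h x v = 0 := by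
  have h1 : Continuous fun x => fderiv ℝ h x v :=
    (hc.continuous_fderiv one_ne_zero).clm_apply continuous_const
  have h2 : HasCompactSupport fun x => fderiv ℝ h x v := hs.fderiv_apply ℝ v
  have := integral_mul_fderiv_eq_neg_fderiv_mul_of_integrable (μ := volume) (f := fun _ : Plane =>
    (1 : ℝ))
    (g := h) (v := v) (by simp) (by simpa using h1.integrable_of_hasCompactSupport h2)
    (by simpa using hc.continuous.integrable_of_hasCompactSupport hs)
    (fun x _ => by fun_prop) (fun x _ => hc.contDiffAt.differentiableAt one_ne_zero)
  simpa using this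

/-- The directional derivative of a regular function is positive in some direction. -/
lemma exists_fderiv_pos {φ : Plane → ℝ} {x : Plane} (h : fderiv ℝ φ x ≠ 0) :
    ∃ e, 0 < fderiv ℝ φ x e := by
  obtain ⟨v, hv⟩ := DFunLike.ne_iff.1 h
  rcases lt_or_gt_of_ne hv with h | h
  · exact ⟨-v, by simpa using h⟩
  · exact ⟨v, h⟩

/-- A function that is `C¹` up to the boundary of `{φ ≥ 0}` and vanishes on `{φ = 0}` is
bounded by a multiple of `φ`. -/
lemma exists_abs_le_mul_of_eq_zero {S : Set Plane} (hS : UniqueDiffOn ℝ S) {φ g : Plane → ℝ}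
    (hφ : ContDiff ℝ ∞ φ) {x₀ : Plane} (hx : x₀ ∈ S) (hφ0 : φ x₀ = 0) (hd : fderiv ℝ φ x₀ ≠ 0)
    (hmem : ∀ᶠ y in nhds x₀, y ∈ S ↔ 0 ≤ φ y) (hg : ContDiffOn ℝ 1 g S)
    (hg0 : ∀ᶠ y in nhds x₀, φ y = 0 → g y = 0) :
    ∃ C, 0 ≤ C ∧ ∀ᶠ y in nhds x₀, 0 < φ y → |g y| ≤ C * φ y := by
  obtain ⟨e, he⟩ := exists_fderiv_pos hd
  -- Half the derivative at `x₀` remains a strict lower bound for the derivative along `e` nearby.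
  set c := fderiv ℝ φ x₀ e / 2 with hc
  have hcpos : 0 < c := by positivity
  have hφd : Continuous fun y => fderiv ℝ φ y e :=
    (hφ.continuous_fderiv (by simp)).clm_apply continuous_const
  have e1 : ∀ᶠ y in nhds x₀, c < fderiv ℝ φ y e :=
    hφd.continuousAt.eventually_const_lt (by linarith)
  set K := ‖fderivWithin ℝ g S x₀‖ + 1
  have e2 : ∀ᶠ y in nhds x₀, y ∈ S → ‖fderivWithin ℝ g S y‖ < K := by
    have h := (hg.continuousOn_fderivWithin hS le_rfl x₀ hx).norm
    exact eventually_nhdsWithin_iff.1 (h.eventually_lt_const (lt_add_one _))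
  obtain ⟨R, hR, hball⟩ := Metric.eventually_nhds_iff_ball.1 (e1.and (e2.and (hmem.and hg0)))
  -- Starting within `R/2` of `x₀`, the segment `y - t • e`, `0 ≤ t ≤ T`, stays in the ball of
  -- radius `R`.
  set T := R / (2 * (‖e‖ + 1)) with hT
  have hTpos : 0 < T := by positivity
  have hTe : T * ‖e‖ < R / 2 := by
    have : T * (‖e‖ + 1) = R / 2 := by rw [hT]; field_simp
    nlinarith
  -- Along `-e` the function `φ` falls at rate at least `c`, so from a value below `c * T` it
  -- reaches `0` by time `T`. The time `t` of that zero satisfies `c * t ≤ φ y`, and the mean value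
  -- inequality for `g` on the segment then gives the constant `K * ‖e‖ / c`.
  have e3 : ∀ᶠ y in nhds x₀, φ y < c * T :=
    hφ.continuous.continuousAt.eventually_lt_const (by rw [hφ0]; positivity)
  refine ⟨K * ‖e‖ / c, by positivity, ?_⟩
  filter_upwards [e3, Metric.ball_mem_nhds x₀ (half_pos hR)] with y hyT hyR hpos
  have hin : ∀ t ∈ Icc 0 T, y - t • e ∈ Metric.ball x₀ R := by
    intro t ht
    rw [Metric.mem_ball, dist_eq_norm] at *
    calc ‖y - t • e - x₀‖ = ‖(y - x₀) - t • e‖ := by congr 1; abel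
      _ ≤ ‖y - x₀‖ + ‖t • e‖ := norm_sub_le _ _
      _ = ‖y - x₀‖ + t * ‖e‖ := by rw [norm_smul, Real.norm_of_nonneg ht.1]
      _ < R / 2 + R / 2 := by
        have : t * ‖e‖ ≤ T * ‖e‖ := by gcongr; exact ht.2
        linarith
      _ = R := by ring
  have hline : ∀ t : ℝ, HasDerivAt (fun t : ℝ => y - t • e) (-e) t := fun t => by
    simpa using ((hasDerivAt_id t).smul_const e).const_sub y
  have hφline : ∀ t : ℝ, HasDerivAt (fun t : ℝ => φ (y - t • e))
      (fderiv ℝ φ (y - t • e) (-e)) t := fun t =>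
    ((hφ.differentiable (by simp)) _).hasFDerivAt.comp_hasDerivAt t (hline t)
  have hcl : Continuous fun t : ℝ => φ (y - t • e) := hφ.continuous.comp (by fun_prop)
  have hdecr : ∀ s ∈ Icc 0 T, ∀ t ∈ Icc 0 T, s ≤ t →
      φ (y - t • e) - φ (y - s • e) ≤ -c * (t - s) := by
    apply (convex_Icc 0 T).image_sub_le_mul_sub_of_deriv_le hcl.continuousOn
      (fun t _ => (hφline t).differentiableAt.differentiableWithinAt)
    intro t ht
    rw [(hφline t).deriv]
    have := (hball _ (hin t (interior_subset ht))).1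
    simp only [map_neg]; linarith
  have hT0 : φ (y - T • e) ≤ 0 := by
    have := hdecr 0 ⟨le_rfl, hTpos.le⟩ T ⟨hTpos.le, le_rfl⟩ hTpos.le
    simp only [zero_smul, sub_zero] at this
    linarith
  obtain ⟨t, ht, ht0⟩ : ∃ t ∈ Icc 0 T, φ (y - t • e) = 0 :=
    intermediate_value_Icc' hTpos.le hcl.continuousOn ⟨hT0, by simpa using hpos.le⟩
  have htφ : c * t ≤ φ y := by
    have := hdecr 0 ⟨le_rfl, hTpos.le⟩ t ht ht.1
    simp only [zero_smul, sub_zero] at this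
    linarith
  have hsub : ∀ s ∈ Icc 0 t, s ∈ Icc 0 T := fun s hs => ⟨hs.1, hs.2.trans ht.2⟩
  -- Because `φ` decreases along the segment, it is nonnegative up to its zero, so the segment stays
  -- in `S`, where `g` is differentiable.
  have hinS : ∀ s ∈ Icc 0 t, y - s • e ∈ S := by
    intro s hs
    rw [(hball _ (hin s (hsub s hs))).2.2.1]
    have := hdecr s (hsub s hs) t ht hs.2
    nlinarith [hs.2]
  have hgline : ∀ s ∈ Icc 0 t, HasDerivWithinAt (fun s : ℝ => g (y - s • e))
      (fderivWithin ℝ g S (y - s • e) (-e)) (Icc 0 t) s := by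
    intro s hs
    exact ((hg.differentiableOn one_ne_zero _ (hinS s hs)).hasFDerivWithinAt).comp_hasDerivWithinAt
      s (hline s).hasDerivWithinAt (fun r hr => hinS r hr)
  have hbd := norm_image_sub_le_of_norm_deriv_le_segment' hgline (C := K * ‖e‖) (by
    intro s hs
    have hs' := Ico_subset_Icc_self hs
    have := (hball _ (hin s (hsub s hs'))).2.1 (hinS s hs')
    calc _ ≤ ‖fderivWithin ℝ g S (y - s • e)‖ * ‖-e‖ := ContinuousLinearMap.le_opNorm _ _
      _ ≤ K * ‖e‖ := by rw [norm_neg]; gcongr) t ⟨ht.1, le_rfl⟩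
  rw [(hball _ (hin t ht)).2.2.2 ht0] at hbd
  simp only [zero_smul, sub_zero, zero_sub, norm_neg, Real.norm_eq_abs] at hbd
  refine hbd.trans ?_
  rw [div_mul_eq_mul_div, le_div_iff₀ hcpos]
  have : 0 ≤ K * ‖e‖ := by positivity
  nlinarith

/-- A divergence-free field on `{φ ≥ 0}` tangential to `{φ = 0}` is orthogonal, near a regular
boundary point, to gradients of test functions (which need not vanish on `{φ = 0}`). -/
lemma exists_nhds_integral_gradDot_eq_zero {S E : Set Plane} (hS : UniqueDiffOn ℝ S)
    (hEm : MeasurableSet E) {φ : Plane → ℝ} {f : Fin 2 → Plane → ℝ}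
    (hφ : ContDiff ℝ ∞ φ) {x₀ : Plane} (hx : x₀ ∈ S) (hφ0 : φ x₀ = 0) (hd : fderiv ℝ φ x₀ ≠ 0)
    (hmem : ∀ᶠ y in nhds x₀, y ∈ S ↔ 0 ≤ φ y) (hE : ∀ᶠ y in nhds x₀, y ∈ E ↔ 0 < φ y)
    (hf : ∀ i, ContDiffOn ℝ 1 (f i) S)
    (hdiv : ∀ᶠ y in nhds x₀, 0 < φ y → planeDiv f y = 0)
    (htan : ∀ᶠ y in nhds x₀, φ y = 0 → gradDot φ f y = 0) :
    ∃ W ∈ nhds x₀, ∀ ψ : Plane → ℝ, ContDiff ℝ ∞ ψ → HasCompactSupport ψ → tsupport ψ ⊆ W →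
      ∫ x in E, gradDot ψ f x = 0 := by
  have hφc := hφ.continuous
  have hdφ : ∀ i, ContDiff ℝ 1 fun y => fderiv ℝ φ y (EuclideanSpace.single i 1) := fun i =>
    (hφ.fderiv_right (m := 1) (by norm_cast)).clm_apply contDiff_const
  have hg : ContDiffOn ℝ 1 (gradDot φ f) S :=
    ContDiffOn.sum fun i _ => (hdφ i).contDiffOn.mul (hf i)
  obtain ⟨C, hC0, hC⟩ := exists_abs_le_mul_of_eq_zero hS hφ hx hφ0 hd hmem hg htan
  have hbf : ∀ i, ∀ᶠ y in nhds x₀, y ∈ S → |f i y| < |f i x₀| + 1 := fun i =>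
    eventually_nhdsWithin_iff.1
      (((hf i).continuousOn x₀ hx).abs.eventually_lt_const (lt_add_one _))
  obtain ⟨η, hη, hη0, hη1, hηb, hdη0, hdη1, K, hK⟩ := exists_cutoff
  have hK0 : 0 ≤ K := (abs_nonneg _).trans (hK 0)
  have hev := (eventually_eventually_nhds.2 hmem).and <| hE.and <| hdiv.and <| hC.and <|
    (hbf 0).and (hbf 1)
  -- The neighbourhood `W` is the set of all points at which the local facts collected in `hev`
  -- hold.
  refine ⟨_, hev, fun ψ hψ hψc hψW => ?_⟩
  have hW : ∀ y ∈ tsupport ψ, _ := fun y hy => hψW hy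
  let χ : ℕ → Plane → ℝ := fun n y => η ((n + 1) * φ y)
  have hχ : ∀ n, ContDiff ℝ ∞ (χ n) := fun n => hη.comp (contDiff_const.mul hφ)
  let h : ℕ → Fin 2 → Plane → ℝ := fun n i y => ψ y * (χ n y * f i y)
  have hSn : ∀ y ∈ tsupport ψ, 0 < φ y → S ∈ nhds y := by
    intro y hy hpos
    filter_upwards [(hW y hy).1, hφc.continuousAt.eventually_const_lt hpos] with z hz hz'
    exact hz.2 hz'.le
  have hneg : ∀ (n : ℕ) y, φ y ≤ 0 → (n + 1 : ℝ) * φ y < 1 := fun n y hy =>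
    (mul_nonpos_of_nonneg_of_nonpos (by positivity) hy).trans_lt one_pos
  have hχ0 : ∀ n, ∀ y, φ y ≤ 0 → χ n =ᶠ[nhds y] fun _ => 0 := by
    intro n y hy
    have : ∀ᶠ z in nhds y, (n + 1 : ℝ) * φ z < 1 :=
      (hφc.const_mul (n + 1 : ℝ)).continuousAt.eventually_lt_const (hneg n y hy)
    filter_upwards [this] with z hz using hη0 _ hz.le
  have hh0 : ∀ n i y, (y ∉ tsupport ψ ∨ φ y ≤ 0) → h n i =ᶠ[nhds y] fun _ => 0 := by
    rintro n i y (hy | hy)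
    · filter_upwards [notMem_tsupport_iff_eventuallyEq.1 hy] with z hz
      simp [h, hz]
    · filter_upwards [hχ0 n y hy] with z hz
      simp [h, hz]
  have hh : ∀ n i, ContDiff ℝ 1 (h n i) := by
    intro n i
    rw [contDiff_iff_contDiffAt]
    intro y
    by_cases hy : y ∉ tsupport ψ ∨ φ y ≤ 0
    · exact contDiffAt_const.congr_of_eventuallyEq (hh0 n i y hy)
    · push Not at hy
      exact (hψ.contDiffAt.of_le (by norm_cast)).mul (((hχ n).contDiffAt.of_le (by norm_cast)).mul
        ((hf i).contDiffAt (hSn y hy.1 hy.2)))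
  have hhc : ∀ n i, HasCompactSupport (h n i) := fun n i => hψc.mul_right
  -- Divergence of `ψ χₙ f`, simplified by `div f = 0`. Its integral is zero because `χₙ` extends
  -- the field by zero across `{φ ≤ 0}` as a compactly supported `C¹` field.
  let D : ℕ → Plane → ℝ := fun n y => χ n y * gradDot ψ f y +
    ψ y * (((n + 1) * deriv η ((n + 1) * φ y)) * gradDot φ f y)
  have hχd : ∀ n y, HasFDerivAt (χ n)
      ((deriv η ((n + 1) * φ y)) • ((n + 1 : ℝ) • fderiv ℝ φ y)) y := by
    intro n y
    have h1 := (hφ.differentiable (by simp) y).hasFDerivAt.const_mul (n + 1 : ℝ)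
    exact ((hη.differentiable (by simp) _).hasDerivAt).comp_hasFDerivAt y h1
  have hψz : ∀ y, y ∉ tsupport ψ → ψ y = 0 ∧ gradDot ψ f y = 0 := by
    intro y hy
    have := notMem_tsupport_iff_eventuallyEq.1 hy
    refine ⟨this.eq_of_nhds, ?_⟩
    simp [gradDot, this.fderiv_eq]
  have hD : ∀ n y, ∑ i, fderiv ℝ (h n i) y (EuclideanSpace.single i 1) = D n y := by
    intro n y
    by_cases hy : y ∉ tsupport ψ ∨ φ y ≤ 0
    · have hz : ∀ i, fderiv ℝ (h n i) y = 0 := fun i => by rw [(hh0 n i y hy).fderiv_eq]; simp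
      simp only [hz]
      rcases hy with hy | hy
      · simp [D, hψz y hy]
      · have : deriv η ((n + 1) * φ y) = 0 := hdη0 _ (hneg n y hy)
        simp [D, this, (hχ0 n y hy).eq_of_nhds]
    · push Not at hy
      have hdv := (hW y hy.1).2.2.1 hy.2
      have dψ := (hψ.differentiable (by simp) y).hasFDerivAt
      have df := fun i => (((hf i).contDiffAt (hSn y hy.1 hy.2)).differentiableAt
        one_ne_zero).hasFDerivAt
      have : ∀ i, fderiv ℝ (h n i) y = _ := fun i => (dψ.mul ((hχd n y).mul (df i))).fderiv
      simp only [this, planeDiv, gradDot, D, Fin.sum_univ_two] at hdv ⊢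
      simp
      linear_combination ψ y * χ n y * hdv
  have hDint : ∀ n, ∫ y, D n y = 0 := by
    intro n
    simp_rw [← hD n]
    rw [integral_finsetSum]
    · exact Finset.sum_eq_zero fun i _ => integral_fderiv_eq_zero (hh n i) (hhc n i) _
    · intro i _
      exact (((hh n i).continuous_fderiv one_ne_zero).clm_apply
        continuous_const).integrable_of_hasCompactSupport ((hhc n i).fderiv_apply ℝ _)
  have hDm : ∀ n, AEStronglyMeasurable (D n) volume := by
    intro n
    have : D n = fun y => ∑ i, fderiv ℝ (h n i) y (EuclideanSpace.single i 1) :=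
      funext fun y => (hD n y).symm
    rw [this]
    exact (continuous_finsetSum _ fun i _ => ((hh n i).continuous_fderiv one_ne_zero).clm_apply
      continuous_const).aestronglyMeasurable
  have hlim : ∀ y, Filter.Tendsto (fun n => D n y) Filter.atTop
      (nhds (E.indicator (gradDot ψ f) y)) := by
    intro y
    by_cases hy : y ∈ tsupport ψ
    · by_cases hpos : 0 < φ y
      · rw [indicator_of_mem ((hW y hy).2.1.2 hpos)]
        -- At a point with `φ y > 0`, once `n > 2 / φ y` the cutoff equals `1` and its derivative is
        -- `0`, so the sequence is eventually constant.
        apply tendsto_const_nhds.congr'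
        obtain ⟨N, hN⟩ := exists_nat_gt (2 / φ y)
        filter_upwards [Filter.eventually_ge_atTop N] with n hn
        have hnN : (N : ℝ) ≤ n := by exact_mod_cast hn
        have h2 : 2 < (n + 1 : ℝ) * φ y := by
          rw [div_lt_iff₀ hpos] at hN
          nlinarith
        simp [D, χ, hη1 _ h2.le, hdη1 _ h2]
      · rw [indicator_of_notMem (fun hm => hpos ((hW y hy).2.1.1 hm))]
        push Not at hpos
        apply tendsto_const_nhds.congr
        intro n
        have : deriv η ((n + 1) * φ y) = 0 := hdη0 _ (hneg n y hpos)
        simp [D, this, (hχ0 n y hpos).eq_of_nhds]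
    · have : E.indicator (gradDot ψ f) y = 0 := by
        by_cases hyE : y ∈ E <;> simp [hyE, (hψz y hy).2]
      rw [this]
      apply tendsto_const_nhds.congr
      intro n
      simp [D, hψz y hy]
  obtain ⟨A, hA⟩ := hψ.continuous.bounded_above_of_compact_support hψc
  have hB := fun i : Fin 2 => ((hψ.continuous_fderiv (by simp)).clm_apply
    (continuous_const (y := (EuclideanSpace.single i 1 : Plane)))).bounded_above_of_compact_support
      (hψc.fderiv_apply ℝ _)
  choose B hB using hB
  have hA0 : 0 ≤ A := (norm_nonneg _).trans (hA 0)
  have hB0 : ∀ i, 0 ≤ B i := fun i => (norm_nonneg _).trans (hB i 0)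
  set M := (B 0 * (|f 0 x₀| + 1) + B 1 * (|f 1 x₀| + 1)) + A * (C * K) with hM
  have hM0 : 0 ≤ M := by have := hB0 0; have := hB0 1; positivity
  have hbound : ∀ n, ∀ᵐ y : Plane, ‖D n y‖ ≤ (tsupport ψ).indicator (fun _ => M) y := by
    intro n
    refine Filter.Eventually.of_forall fun y => ?_
    by_cases hy : y ∈ tsupport ψ
    · rw [indicator_of_mem hy]
      by_cases hpos : 0 < φ y
      · obtain ⟨-, -, -, hCy, hf0, hf1⟩ := hW y hy
        have hyS := mem_of_mem_nhds (hSn y hy hpos)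
        have n1 : |gradDot ψ f y| ≤ B 0 * (|f 0 x₀| + 1) + B 1 * (|f 1 x₀| + 1) := by
          rw [gradDot, Fin.sum_univ_two]
          refine (abs_add_le _ _).trans ?_
          rw [abs_mul, abs_mul]
          have := hB 0 y; have := hB 1 y
          have := hB0 0; have := hB0 1
          simp only [Real.norm_eq_abs] at *
          gcongr
          · exact (hf0 hyS).le
          · exact (hf1 hyS).le
        -- With `t = (n + 1) * φ y`, the bound `C * φ y` on the normal component turns the factor `n
        -- + 1` into `t`, and `|t * η'(t)| ≤ K`.
        have n2 : |((n + 1) * deriv η ((n + 1) * φ y)) * gradDot φ f y| ≤ C * K := by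
          calc _ = |(n + 1) * deriv η ((n + 1) * φ y)| * |gradDot φ f y| := abs_mul _ _
            _ ≤ |(n + 1) * deriv η ((n + 1) * φ y)| * (C * φ y) := by gcongr; exact hCy hpos
            _ = C * |((n + 1) * φ y) * deriv η ((n + 1) * φ y)| := by
              rw [abs_mul, abs_mul, abs_mul, abs_of_pos hpos]; ring
            _ ≤ C * K := by gcongr; exact hK _
        calc ‖D n y‖ ≤ |χ n y * gradDot ψ f y| + |ψ y *
              (((n + 1) * deriv η ((n + 1) * φ y)) * gradDot φ f y)| := abs_add_le _ _
          _ = |χ n y| * |gradDot ψ f y| + |ψ y| *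
              |((n + 1) * deriv η ((n + 1) * φ y)) * gradDot φ f y| := by
            rw [abs_mul, abs_mul (ψ y)]
          _ ≤ 1 * (B 0 * (|f 0 x₀| + 1) + B 1 * (|f 1 x₀| + 1)) + A * (C * K) := by
            gcongr
            · exact hηb _
            · exact hA y
          _ = M := by rw [one_mul]
      · push Not at hpos
        have : deriv η ((n + 1) * φ y) = 0 := hdη0 _ (hneg n y hpos)
        simpa [D, this, (hχ0 n y hpos).eq_of_nhds] using hM0
    · rw [indicator_of_notMem hy]
      simp [D, hψz y hy]
  have hlimint := tendsto_integral_of_dominated_convergence _ hDm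
    ((integrable_indicator_iff hψc.isCompact.measurableSet).2
      (integrableOn_const hψc.isCompact.measure_ne_top)) hbound
    (Filter.Eventually.of_forall hlim)
  simp_rw [hDint] at hlimint
  rw [← integral_indicator hEm]
  exact (tendsto_nhds_unique hlimint tendsto_const_nhds)

/-! ### Local defining functions -/

lemma fderiv_ne_zero_iff_gradient {φ : Plane → ℝ} {x : Plane} :
    ∇ φ x ≠ 0 ↔ fderiv ℝ φ x ≠ 0 := by
  simp [gradient]

lemma eventually_pos_of_fderiv_pos {φ : Plane → ℝ} {x v : Plane} (hφ : DifferentiableAt ℝ φ x)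
    (hx : φ x = 0) (hv : 0 < fderiv ℝ φ x v) :
    ∀ᶠ t in nhdsWithin (0 : ℝ) (Ioi 0), 0 < φ (x + t • v) := by
  have hline : HasDerivAt (fun t : ℝ => x + t • v) v 0 := by
    simpa using ((hasDerivAt_id (0 : ℝ)).smul_const v).const_add x
  have hφ' : HasFDerivAt φ (fderiv ℝ φ x) (x + (0 : ℝ) • v) := by simpa using hφ.hasFDerivAt
  have hd : HasDerivAt (fun t : ℝ => φ (x + t • v)) (fderiv ℝ φ x v) 0 :=
    hφ'.comp_hasDerivAt 0 hline
  have hs := (hasDerivAt_iff_tendsto_slope.1 hd).mono_left (nhdsGT_le_nhdsNE 0)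
  filter_upwards [hs.eventually_const_lt hv, self_mem_nhdsWithin] with t ht ht0
  have ht0' : (0 : ℝ) < t := ht0
  rw [slope_def_field] at ht
  simp only [zero_smul, add_zero, hx, sub_zero] at ht
  exact (div_pos_iff_of_pos_right ht0').1 ht

/-- Moving from `x` in a direction along which `φ` decreases enters `{φ < 0}`. Hence a local
defining function can exist only at a boundary point. -/
lemma IsLocalDefiningFunction.mem_closure {D : Set Plane} {x : Plane} {φ : Plane → ℝ}
    (h : IsLocalDefiningFunction D x φ) : x ∈ closure D := by
  obtain ⟨e, he⟩ := exists_fderiv_pos (fderiv_ne_zero_iff_gradient.1 h.gradient_ne)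
  have hd := h.smooth.differentiable (by simp) x
  have h1 := eventually_pos_of_fderiv_pos (φ := -φ) (v := -e) hd.neg (by simp [h.zero])
    (by rw [fderiv_neg]; simpa using he)
  have hc : Filter.Tendsto (fun t : ℝ => x + t • -e) (nhdsWithin 0 (Ioi 0)) (nhds x) := by
    have : Continuous fun t : ℝ => x + t • -e := by fun_prop
    simpa using (this.tendsto 0).mono_left nhdsWithin_le_nhds
  refine mem_closure_of_tendsto hc ?_
  filter_upwards [h1, hc.eventually h.mem_iff] with t ht1 ht2
  exact ht2.2 (by simpa using ht1)

lemma IsLocalDefiningFunction.notMem {D : Set Plane} {x : Plane} {φ : Plane → ℝ}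
    (h : IsLocalDefiningFunction D x φ) : x ∉ D := fun hx =>
  (h.mem_iff.self_of_nhds.1 hx).ne h.zero

lemma IsLocalDefiningFunction.mem_frontier {D : Set Plane} {x : Plane} {φ : Plane → ℝ}
    (h : IsLocalDefiningFunction D x φ) : x ∈ frontier D :=
  ⟨h.mem_closure, fun hx => h.notMem (interior_subset hx)⟩

/-- One `φ` serves all nearby boundary points, so the tangency condition becomes available on `{φ =
0}` near `x` and not just at `x`. -/
lemma IsLocalDefiningFunction.eventually_self {D : Set Plane} {x : Plane} {φ : Plane → ℝ}
    (h : IsLocalDefiningFunction D x φ) :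
    ∀ᶠ y in nhds x, φ y = 0 → IsLocalDefiningFunction D y φ := by
  have h1 : ∀ᶠ y in nhds x, fderiv ℝ φ y ≠ 0 :=
    (h.smooth.continuous_fderiv (by simp)).continuousAt.eventually_ne
      (fderiv_ne_zero_iff_gradient.1 h.gradient_ne)
  filter_upwards [h1, eventually_eventually_nhds.2 h.mem_iff] with y hy hm h0
  exact ⟨h.smooth, h0, fderiv_ne_zero_iff_gradient.2 hy, hm⟩

/-- Regularity excludes slits: the closure adds exactly `{φ = 0}`. Thus `Y` is locally `{φ > 0}`,
while the set carrying the boundary values is `{φ ≥ 0}`. -/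
lemma IsLocalDefiningFunction.eventually_mem_closure {D : Set Plane} {x : Plane} {φ : Plane → ℝ}
    (h : IsLocalDefiningFunction D x φ) :
    ∀ᶠ y in nhds x, y ∈ closure D ↔ φ y ≤ 0 := by
  filter_upwards [h.eventually_self, eventually_eventually_nhds.2 h.mem_iff] with y h0 hm
  constructor
  · intro hy
    by_contra hpos
    push Not at hpos
    have : ∀ᶠ z in nhds y, z ∉ D := by
      filter_upwards [hm, h.smooth.continuous.continuousAt.eventually_const_lt hpos] with z hz hz'
      rw [hz]; exact not_lt.2 hz'.le
    exact (mem_closure_iff_frequently.1 hy) this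
  · intro hy
    rcases hy.lt_or_eq with hlt | heq
    · exact subset_closure (hm.self_of_nhds.2 hlt)
    · exact (h0 heq).mem_closure

/-- Complements of sets with regular boundary are sets of unique differentiability. -/
lemma IsLocalDefiningFunction.uniqueDiffWithinAt {D A : Set Plane} {x : Plane} {φ : Plane → ℝ}
    (h : IsLocalDefiningFunction D x φ) (hA : A ∈ nhds x) : UniqueDiffWithinAt ℝ (A \ D) x := by
  obtain ⟨e, he⟩ := exists_fderiv_pos (fderiv_ne_zero_iff_gradient.1 h.gradient_ne)
  have hcone : ∀ v, 0 < fderiv ℝ φ x v → v ∈ tangentConeAt ℝ (A \ D) x := by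
    intro v hv
    refine mem_tangentConeAt_of_add_smul_mem (Filter.tendsto_id'.mpr <| nhdsGT_le_nhdsNE 0) ?_
    have hc : Filter.Tendsto (fun t : ℝ => x + t • v) (nhdsWithin 0 (Ioi 0)) (nhds x) := by
      have : Continuous fun t : ℝ => x + t • v := by fun_prop
      simpa using (this.tendsto 0).mono_left nhdsWithin_le_nhds
    filter_upwards [eventually_pos_of_fderiv_pos (h.smooth.differentiable (by simp) x) h.zero hv,
      hc.eventually h.mem_iff, hc.eventually hA] with t h1 h2 h3
    exact ⟨h3, fun hD => (h2.1 hD).not_gt h1⟩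
  refine (uniqueDiffWithinAt_iff ..).2 ⟨?_, subset_closure ⟨mem_of_mem_nhds hA, h.notMem⟩⟩
  -- An open half-plane spans: any `w` is `(w + c • e) - c • e`, and both terms lie in the cone up
  -- to scaling once `c` is large.
  have : Submodule.span ℝ (tangentConeAt ℝ (A \ D) x) = ⊤ := by
    refine Submodule.eq_top_iff'.2 fun w => ?_
    set c := |fderiv ℝ φ x w| / fderiv ℝ φ x e + 1
    have hce : |fderiv ℝ φ x w| < c * fderiv ℝ φ x e := by
      rw [add_mul, div_mul_cancel₀ _ he.ne']; linarith
    have h1 : w + c • e ∈ tangentConeAt ℝ (A \ D) x := by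
      apply hcone
      simp only [map_add, map_smul, smul_eq_mul]
      linarith [neg_abs_le (fderiv ℝ φ x w)]
    have := Submodule.sub_mem _ (Submodule.subset_span h1)
      (Submodule.smul_mem _ c (Submodule.subset_span (hcone e he)))
    simpa using this
  rw [this]
  exact dense_univ

/-! ### Regular holes and the perforated square -/

/-- Open sets with regular boundary, with closure in the open unit square. -/
structure IsRegularHole (G : Set Plane) : Prop where
  isOpen : IsOpen G
  closure_subset : closure G ⊆ openSquare
  exists_defining : ∀ x ∈ frontier G, ∃ φ, IsLocalDefiningFunction G x φ

/-- Finitely many disjoint closures: near a boundary point of one component the others are absent,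
so the defining function of that component also defines the union. -/
lemma IsHoleSet.isRegularHole {G₀ : Set Plane} (h : IsHoleSet G₀) : IsRegularHole G₀ := by
  obtain ⟨⟨n, G, rfl, hsm, hsub, hdisj⟩, -⟩ := h
  have hcl : closure (⋃ i, G i) = ⋃ i, closure (G i) := closure_iUnion_of_finite G
  refine ⟨isOpen_iUnion fun i => (hsm i).isOpen, ?_, ?_⟩
  · rw [hcl]; exact iUnion_subset hsub
  · intro x hx
    have hxo : x ∉ ⋃ i, G i := by
      rw [(isOpen_iUnion fun i => (hsm i).isOpen).frontier_eq] at hx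
      exact hx.2
    have hxc := hx.1
    rw [hcl] at hxc
    obtain ⟨i, hi⟩ := mem_iUnion.1 hxc
    have hif : x ∈ frontier (G i) := by
      rw [(hsm i).isOpen.frontier_eq]
      exact ⟨hi, fun hx' => hxo (mem_iUnion.2 ⟨i, hx'⟩)⟩
    obtain ⟨φ, hφ⟩ := (hsm i).smooth_boundary x hif
    refine ⟨φ, hφ.smooth, hφ.zero, hφ.gradient_ne, ?_⟩
    have hj : ∀ j, j ≠ i → ∀ᶠ y in nhds x, y ∉ G j := by
      intro j hji
      have : x ∉ closure (G j) := fun hxj => (hdisj hji).le_bot ⟨hxj, hi⟩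
      filter_upwards [isClosed_closure.isOpen_compl.mem_nhds this] with y hy hyj
      exact hy (subset_closure hyj)
    have hall : ∀ᶠ y in nhds x, ∀ j, j ≠ i → y ∉ G j := by
      rw [Filter.eventually_all]
      intro j
      by_cases hji : j = i
      · simp [hji]
      · filter_upwards [hj j hji] with y hy _ using hy
    filter_upwards [hφ.mem_iff, hall] with y hy hyj
    rw [← hy, mem_iUnion]
    constructor
    · rintro ⟨j, hj⟩
      by_cases hji : j = i
      · rwa [← hji]
      · exact absurd hj (hyj j hji)
    · exact fun hyi => ⟨i, hyi⟩

lemma isOpen_openSquare : IsOpen openSquare := by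
  have : openSquare = {ξ : Plane | ξ 0 ∈ Ioo (0 : ℝ) 1 ∧ ξ 1 ∈ Ioo (0 : ℝ) 1} := by
    ext ξ; simp only [openSquare, mem_ofPred_eq, Fin.forall_fin_two]
  rw [this]; exact isOpen_openBox 0 1

lemma openSquare_subset : openSquare ⊆ closedSquare := fun _ h i => Ioo_subset_Icc_self (h i)

lemma isCompact_closedSquare : IsCompact closedSquare := by
  rw [closedSquare_eq_periodBox]; exact isCompact_periodBox 0 1

lemma closedSquare_mem_nhds {x : Plane} (hx : x ∈ openSquare) : closedSquare ∈ nhds x :=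
  Filter.mem_of_superset (isOpen_openSquare.mem_nhds hx) openSquare_subset

/-- The perforated closed unit square with the boundaries of the holes included. -/
def perfSquare (G : Set Plane) : Set Plane := closedSquare \ G

lemma uniqueDiffWithinAt_perfSquare {G : Set Plane} {x : Plane} (hx : x ∈ closedSquare)
    (hG : x ∉ closure G) : UniqueDiffWithinAt ℝ (perfSquare G) x := by
  have h1 : UniqueDiffWithinAt ℝ closedSquare x := by
    rw [closedSquare_eq_periodBox] at *
    exact uniqueDiffOn_periodBox one_pos x hx
  refine (h1.inter (isClosed_closure.isOpen_compl.mem_nhds hG)).mono ?_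
  exact fun y hy => ⟨hy.1, fun h => hy.2 (subset_closure h)⟩

namespace IsRegularHole

/-- Makes within-derivatives well defined and smooth up to the hole boundaries and the sides of the
square. -/
lemma uniqueDiffOn_perfSquare {G : Set Plane} (hG : IsRegularHole G) :
    UniqueDiffOn ℝ (perfSquare G) := by
  intro x hx
  by_cases hxc : x ∈ closure G
  · obtain ⟨φ, hφ⟩ := hG.exists_defining x (by rw [hG.isOpen.frontier_eq]; exact ⟨hxc, hx.2⟩)
    exact hφ.uniqueDiffWithinAt (closedSquare_mem_nhds (hG.closure_subset hxc))
  · exact uniqueDiffWithinAt_perfSquare hx.1 hxc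

lemma isCompact_perfSquare {G : Set Plane} (hG : IsRegularHole G) :
    IsCompact (perfSquare G) :=
  isCompact_closedSquare.diff hG.isOpen

end IsRegularHole

lemma perfSquare_mem_nhds {G : Set Plane} {x : Plane} (hx : x ∈ openSquare)
    (hG : x ∉ closure G) : perfSquare G ∈ nhds x := by
  filter_upwards [isClosed_closure.isOpen_compl.mem_nhds hG, closedSquare_mem_nhds hx] with y h1 h2
  exact ⟨h2, fun h => h1 (subset_closure h)⟩

lemma cellY_subset (G : Set Plane) : cellY G ⊆ perfSquare G :=
  sdiff_subset_sdiff_right subset_closure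

lemma measurableSet_cellY (G : Set Plane) : MeasurableSet (cellY G) :=
  isCompact_closedSquare.measurableSet.diff isClosed_closure.measurableSet

/-! ### Green's formula on the periodicity cell -/

/-- A divergence-free vector field on the perforated square, tangential to the holes. -/
structure IsSolenoidal (G : Set Plane) (f : Fin 2 → Plane → ℝ) : Prop where
  contDiffOn : ∀ i, ContDiffOn ℝ 1 (f i) (perfSquare G)
  div_eq_zero : ∀ x ∈ openSquare, x ∉ closure G → planeDiv f x = 0
  tangential : ∀ x φ, IsLocalDefiningFunction G x φ → gradDot φ f x = 0

lemma integrableOn_gradDot {G : Set Plane} (hG : IsRegularHole G) {f : Fin 2 → Plane → ℝ}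
    (hf : IsSolenoidal G f)
    {ψ : Plane → ℝ} (hψ : ContDiff ℝ ∞ ψ) :
    IntegrableOn (gradDot ψ f) (cellY G) := by
  have : ContinuousOn (gradDot ψ f) (perfSquare G) := by
    refine continuousOn_finsetSum _ fun i _ => ContinuousOn.mul ?_ (hf.contDiffOn i).continuousOn
    exact ((hψ.continuous_fderiv (by simp)).clm_apply continuous_const).continuousOn
  exact (this.integrableOn_compact hG.isCompact_perfSquare).mono_set (cellY_subset G)

/-- Three kinds of points: inside a hole the integrand vanishes on `Y`; on a hole boundary the
cutoff argument applies; elsewhere the field `ψ f` is compactly supported and `C¹`. -/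
lemma exists_nhds_integral_cellY_eq_zero {G : Set Plane} (hG : IsRegularHole G)
    {f : Fin 2 → Plane → ℝ} (hf : IsSolenoidal G f)
    {x : Plane} (hx : x ∈ openSquare) :
    ∃ W ∈ nhds x, ∀ ψ : Plane → ℝ, ContDiff ℝ ∞ ψ → HasCompactSupport ψ → tsupport ψ ⊆ W →
      ∫ y in cellY G, gradDot ψ f y = 0 := by
  by_cases hxc : x ∈ closure G
  · by_cases hxG : x ∈ G
    · refine ⟨G, hG.isOpen.mem_nhds hxG, fun ψ _ _ hψG => ?_⟩
      refine setIntegral_eq_zero_of_forall_eq_zero fun y hy => ?_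
      have : y ∉ tsupport ψ := fun h => hy.2 (subset_closure (hψG h))
      have := notMem_tsupport_iff_eventuallyEq.1 this
      simp [gradDot, this.fderiv_eq]
    · obtain ⟨φ, hφ⟩ := hG.exists_defining x (by rw [hG.isOpen.frontier_eq]; exact ⟨hxc, hxG⟩)
      have hsq := isOpen_openSquare.mem_nhds hx
      refine exists_nhds_integral_gradDot_eq_zero hG.uniqueDiffOn_perfSquare
        (measurableSet_cellY G) hφ.smooth ⟨openSquare_subset hx, hxG⟩ hφ.zero
        (fderiv_ne_zero_iff_gradient.1 hφ.gradient_ne) ?_ ?_ hf.contDiffOn ?_ ?_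
      · filter_upwards [hsq, hφ.mem_iff] with y hy hm
        rw [← not_lt, ← hm]
        exact ⟨fun h => h.2, fun h => ⟨openSquare_subset hy, h⟩⟩
      · filter_upwards [hsq, hφ.eventually_mem_closure] with y hy hm
        rw [← not_le, ← hm]
        exact ⟨fun h => h.2, fun h => ⟨openSquare_subset hy, h⟩⟩
      · filter_upwards [hsq, hφ.eventually_mem_closure] with y hy hm hpos
        exact hf.div_eq_zero y hy fun h => (hm.1 h).not_gt hpos
      · filter_upwards [hφ.eventually_self] with y hy h0
        exact hf.tangential y φ (hy h0)
  · refine ⟨openSquare ∩ (closure G)ᶜ, (isOpen_openSquare.inter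
      isClosed_closure.isOpen_compl).mem_nhds ⟨hx, hxc⟩, fun ψ hψ hψc hψW => ?_⟩
    have hh : ∀ i, ContDiff ℝ 1 fun y => ψ y * f i y := by
      intro i
      rw [contDiff_iff_contDiffAt]
      intro y
      by_cases hy : y ∈ tsupport ψ
      · exact (hψ.contDiffAt.of_le (by norm_cast)).mul
          ((hf.contDiffOn i).contDiffAt (perfSquare_mem_nhds (hψW hy).1 (hψW hy).2))
      · apply contDiffAt_const (c := (0 : ℝ)) |>.congr_of_eventuallyEq
        filter_upwards [notMem_tsupport_iff_eventuallyEq.1 hy] with z hz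
        simp [hz]
    have hsum : ∀ y, gradDot ψ f y =
        ∑ i, fderiv ℝ (fun y => ψ y * f i y) y (EuclideanSpace.single i 1) := by
      intro y
      by_cases hy : y ∈ tsupport ψ
      · have hdv := hf.div_eq_zero y (hψW hy).1 (hψW hy).2
        have dψ := (hψ.differentiable (by simp) y).hasFDerivAt
        have df := fun i => (((hf.contDiffOn i).contDiffAt (perfSquare_mem_nhds (hψW hy).1
          (hψW hy).2)).differentiableAt one_ne_zero).hasFDerivAt
        have : ∀ i, fderiv ℝ (fun y => ψ y * f i y) y = _ := fun i => (dψ.mul (df i)).fderiv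
        simp only [this, planeDiv, gradDot, Fin.sum_univ_two] at hdv ⊢
        simp
        linear_combination - ψ y * hdv
      · have h0 := notMem_tsupport_iff_eventuallyEq.1 hy
        have : ∀ i, fderiv ℝ (fun y => ψ y * f i y) y = 0 := by
          intro i
          have : (fun y => ψ y * f i y) =ᶠ[nhds y] fun _ => 0 := by
            filter_upwards [h0] with z hz
            simp [hz]
          rw [this.fderiv_eq]; simp
        simp [gradDot, h0.fderiv_eq, this]
    have hz : ∀ y, y ∉ cellY G → gradDot ψ f y = 0 := by
      intro y hy
      have : y ∉ tsupport ψ := fun h => hy ⟨openSquare_subset (hψW h).1, (hψW h).2⟩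
      have := notMem_tsupport_iff_eventuallyEq.1 this
      simp [gradDot, this.fderiv_eq]
    rw [setIntegral_eq_integral_of_forall_compl_eq_zero hz]
    simp_rw [hsum]
    rw [integral_finsetSum]
    · exact Finset.sum_eq_zero fun i _ => integral_fderiv_eq_zero (hh i) hψc.mul_right _
    · intro i _
      exact (((hh i).continuous_fderiv one_ne_zero).clm_apply
        continuous_const).integrable_of_hasCompactSupport ((hψc.mul_right).fderiv_apply ℝ _)

/-- The weak form of the equation, for test functions supported in the open unit square. -/
lemma integral_cellY_gradDot_eq_zero {G : Set Plane} (hG : IsRegularHole G)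
    {f : Fin 2 → Plane → ℝ} (hf : IsSolenoidal G f)
    {ψ : Plane → ℝ} (hψ : ContDiff ℝ ∞ ψ)
    (hψc : HasCompactSupport ψ) (hψs : tsupport ψ ⊆ openSquare) :
    ∫ y in cellY G, gradDot ψ f y = 0 := by
  choose! W hW hWψ using fun x (hx : x ∈ openSquare) =>
    exists_nhds_integral_cellY_eq_zero hG hf hx
  obtain ⟨ρ, hρ⟩ := SmoothPartitionOfUnity.exists_isSubordinate 𝓘(ℝ, Plane)
    (isClosed_tsupport ψ) (fun x : tsupport ψ => interior (W x)) (fun _ => isOpen_interior)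
    (fun x hx => mem_iUnion.2 ⟨⟨x, hx⟩, mem_interior_iff_mem_nhds.2 (hW x (hψs hx))⟩)
  -- Only finitely many members of the partition meet the compact support of `ψ`, so the
  -- decomposition of `ψ` is a finite sum.
  have hfin := ρ.locallyFinite.finite_nonempty_inter_compact hψc.isCompact
  have hρs : ∀ i, ContDiff ℝ ∞ (ρ i) := fun i => (ρ i).contMDiff.contDiff
  have hsum : ψ = fun y => ∑ i ∈ hfin.toFinset, ρ i y * ψ y := by
    funext y
    by_cases hy : y ∈ tsupport ψ
    · rw [← Finset.sum_mul]
      have h1 := ρ.sum_eq_one hy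
      rw [finsum_eq_sum_of_support_subset (s := hfin.toFinset)] at h1
      · rw [h1, one_mul]
      · intro i hi
        rw [Finite.coe_toFinset]
        exact ⟨y, hi, hy⟩
    · simp [image_eq_zero_of_notMem_tsupport hy]
  have hgrad : ∀ y, gradDot ψ f y =
      ∑ i ∈ hfin.toFinset, gradDot (fun y => ρ i y * ψ y) f y := by
    intro y
    have : fderiv ℝ ψ y = ∑ i ∈ hfin.toFinset, fderiv ℝ (fun y => ρ i y * ψ y) y := by
      conv_lhs => rw [hsum]
      rw [fderiv_fun_sum]
      intro i _
      exact ((hρs i).mul hψ).differentiable (by simp) y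
    simp only [gradDot, this, sum_apply, Finset.sum_mul]
    exact Finset.sum_comm
  simp_rw [hgrad]
  rw [integral_finsetSum]
  · refine Finset.sum_eq_zero fun i _ => ?_
    refine hWψ i (hψs i.2) _ ((hρs i).mul hψ) hψc.mul_left ?_
    exact (tsupport_mul_subset_left).trans ((hρ i).trans interior_subset)
  · intro i _
    exact integrableOn_gradDot hG hf ((hρs i).mul hψ)

/-- Separates the two boundaries: `κψ` does not reach the sides of the square, and `(1 - κ)ψ` does
not reach the holes. -/
lemma exists_cutoff_eq_one_near_hole {G : Set Plane} (hG : IsRegularHole G) :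
    ∃ κ : Plane → ℝ, ContDiff ℝ ∞ κ ∧ HasCompactSupport κ ∧
    tsupport κ ⊆ openSquare ∧ ∀ x ∈ closure G, κ =ᶠ[nhds x] fun _ => 1 := by
  obtain ⟨κ, h0, h1, -⟩ := exists_contMDiffMap_zero_one_nhds_of_isClosed 𝓘(ℝ, Plane) (n := ⊤)
    (s := openSquareᶜ) (t := closure G) isOpen_openSquare.isClosed_compl isClosed_closure
    (disjoint_compl_left_iff_subset.2 hG.closure_subset)
  have hsub : tsupport κ ⊆ openSquare := by
    intro x hx
    by_contra hxs
    refine notMem_tsupport_iff_eventuallyEq.2 ?_ hx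
    exact h0.filter_mono (nhds_le_nhdsSet hxs)
  exact ⟨κ, κ.contMDiff.contDiff, isCompact_closedSquare.of_isClosed_subset
    (isClosed_tsupport _) (hsub.trans openSquare_subset), hsub,
    fun x hx => h1.filter_mono (nhds_le_nhdsSet hx)⟩

/-- The Green formula on the periodicity cell. -/
theorem integral_cellY_gradDot {G : Set Plane} (hG : IsRegularHole G) {f : Fin 2 → Plane → ℝ}
    (hf : IsSolenoidal G f)
    {ψ : Plane → ℝ} (hψ : ContDiff ℝ ∞ ψ) :
    ∫ x in cellY G, gradDot ψ f x =
      (∫ y in (0 : ℝ)..1, ψ !₂[1, y] * f 0 !₂[1, y]) -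
        (∫ y in (0 : ℝ)..1, ψ !₂[0, y] * f 0 !₂[0, y]) +
      ((∫ x in (0 : ℝ)..1, ψ !₂[x, 1] * f 1 !₂[x, 1]) -
        ∫ x in (0 : ℝ)..1, ψ !₂[x, 0] * f 1 !₂[x, 0]) := by
  obtain ⟨κ, hκ, hκc, hκs, hκ1⟩ := exists_cutoff_eq_one_near_hole hG
  have h1 := integral_cellY_gradDot_eq_zero hG hf (hκ.mul hψ) hκc.mul_right
    (tsupport_mul_subset_left.trans hκs)
  -- The part `κψ` contributes nothing by the weak form. Since `θ` vanishes near the holes, `θ f` is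
  -- `C¹` on the whole square, and the rectangle theorem applies to it.
  set θ : Plane → ℝ := fun x => (1 - κ x) * ψ x with hθ
  have hθs : ContDiff ℝ ∞ θ := (contDiff_const.sub hκ).mul hψ
  have hsplit : ∀ x, gradDot ψ f x = gradDot (fun x => κ x * ψ x) f x + gradDot θ f x := by
    intro x
    have h : ψ = fun x => κ x * ψ x + θ x := by funext x; simp only [hθ]; ring
    have hd : fderiv ℝ ψ x = fderiv ℝ (fun x => κ x * ψ x) x + fderiv ℝ θ x := by
      conv_lhs => rw [h]
      exact fderiv_fun_add ((hκ.mul hψ).differentiable (by simp) x)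
        (hθs.differentiable (by simp) x)
    simp only [gradDot, hd, add_apply, add_mul, Finset.sum_add_distrib]
  simp_rw [hsplit]
  rw [integral_add (integrableOn_gradDot hG hf (hκ.mul hψ)) (integrableOn_gradDot hG hf hθs), h1,
    zero_add]
  let H : Fin 2 → Plane → ℝ := fun i x => θ x * f i x
  have hθ0 : ∀ x ∈ closure G, θ =ᶠ[nhds x] fun _ => 0 := by
    intro x hx
    filter_upwards [hκ1 x hx] with y hy
    simp [hθ, hy]
  have hH : ∀ i, ContDiffOn ℝ 1 (H i) (periodBox 0 1) := by
    intro i x hx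
    rw [← closedSquare_eq_periodBox] at hx ⊢
    by_cases hxG : x ∈ closure G
    · apply ContDiffAt.contDiffWithinAt
      apply contDiffAt_const (c := (0 : ℝ)) |>.congr_of_eventuallyEq
      filter_upwards [hθ0 x hxG] with y hy
      simp [H, hy]
    · have hw : ContDiffWithinAt ℝ 1 (f i) closedSquare x := by
        refine ((hf.contDiffOn i) x ⟨hx, fun h => hxG (subset_closure h)⟩).mono_of_mem_nhdsWithin ?_
        filter_upwards [self_mem_nhdsWithin,
          nhdsWithin_le_nhds (isClosed_closure.isOpen_compl.mem_nhds hxG)] with y hy hy'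
        exact ⟨hy, fun h => hy' (subset_closure h)⟩
      exact (hθs.contDiffAt.of_le (by norm_cast)).contDiffWithinAt.mul hw
  have key := integral_divergence_periodBox one_pos hH
  have hθψ : ∀ x, x ∉ openSquare → θ x = ψ x := by
    intro x hx
    have : κ x = 0 := image_eq_zero_of_notMem_tsupport fun h => hx (hκs h)
    simp [hθ, this]
  have hb1 : ∀ y : ℝ, H 0 !₂[1, y] = ψ !₂[1, y] * f 0 !₂[1, y] := fun y => by
    simp only [H]; rw [hθψ]; intro h; simpa using (h 0).2
  have hb2 : ∀ y : ℝ, H 0 !₂[0, y] = ψ !₂[0, y] * f 0 !₂[0, y] := fun y => by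
    simp only [H]; rw [hθψ]; intro h; simpa using (h 0).1
  have hb3 : ∀ x : ℝ, H 1 !₂[x, 1] = ψ !₂[x, 1] * f 1 !₂[x, 1] := fun y => by
    simp only [H]; rw [hθψ]; intro h; simpa using (h 1).2
  have hb4 : ∀ x : ℝ, H 1 !₂[x, 0] = ψ !₂[x, 0] * f 1 !₂[x, 0] := fun y => by
    simp only [H]; rw [hθψ]; intro h; simpa using (h 1).1
  simp_rw [hb1, hb2, hb3, hb4] at key
  rw [← key]
  have hcell : cellY G ⊆ periodBox 0 1 := by
    rw [← closedSquare_eq_periodBox]; exact sdiff_subset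
  rw [← setIntegral_eq_of_subset_of_forall_sdiff_eq_zero
    (isCompact_periodBox 0 1).measurableSet hcell]
  · refine setIntegral_congr_ae (isCompact_periodBox 0 1).measurableSet ?_
    filter_upwards [ae_mem_openBox 0 1] with x hx hxs
    obtain ⟨hx0, hx1⟩ := hx hxs
    have hm := periodBox_mem_nhds hx0 hx1
    have hxo : x ∈ openSquare := by
      intro i; fin_cases i
      · exact hx0
      · exact hx1
    simp only [partialIn, fderivWithin_of_mem_nhds hm]
    by_cases hxG : x ∈ closure G
    · have h0 := hθ0 x hxG
      have : ∀ i, fderiv ℝ (H i) x = 0 := by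
        intro i
        have : H i =ᶠ[nhds x] fun _ => 0 := by
          filter_upwards [h0] with z hz
          simp [H, hz]
        rw [this.fderiv_eq]; simp
      simp [gradDot, h0.fderiv_eq, this]
    · have hdv := hf.div_eq_zero x hxo hxG
      have dθ := (hθs.differentiable (by simp) x).hasFDerivAt
      have df := fun i => (((hf.contDiffOn i).contDiffAt
        (perfSquare_mem_nhds hxo hxG)).differentiableAt one_ne_zero).hasFDerivAt
      have : ∀ i, fderiv ℝ (H i) x = _ := fun i => (dθ.mul (df i)).fderiv
      simp only [this, planeDiv, gradDot, Fin.sum_univ_two] at hdv ⊢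
      simp
      linear_combination - θ x * hdv
  · intro x hx
    have hxG : x ∈ closure G := by
      by_contra h
      exact hx.2 ⟨by rw [closedSquare_eq_periodBox]; exact hx.1, h⟩
    simp [gradDot, (hθ0 x hxG).fderiv_eq]

/-- The flux of a solenoidal field through the vertical sides, when the field is periodic
in the second variable. -/
theorem flux_left_eq_flux_right {G : Set Plane} (hG : IsRegularHole G) {f : Fin 2 → Plane → ℝ}
    (hf : IsSolenoidal G f)
    (hper : ∀ x ∈ Icc (0 : ℝ) 1, f 1 !₂[x, 1] = f 1 !₂[x, 0]) :
    ∫ y in (0 : ℝ)..1, f 0 !₂[1, y] = ∫ y in (0 : ℝ)..1, f 0 !₂[0, y] := by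
  have h := integral_cellY_gradDot hG hf (ψ := fun _ => 1) contDiff_const
  have h2 : ∫ x in (0 : ℝ)..1, f 1 !₂[x, 1] = ∫ x in (0 : ℝ)..1, f 1 !₂[x, 0] :=
    intervalIntegral.integral_congr fun x hx => hper x (by rwa [uIcc_of_le zero_le_one] at hx)
  simp only [gradDot, fderiv_fun_const, one_mul, h2] at h
  simp at h
  linarith

/-- The integral over the cell of the first component of a solenoidal field is its flux. -/
theorem integral_cellY_eq_flux {G : Set Plane} (hG : IsRegularHole G) {f : Fin 2 → Plane → ℝ}
    (hf : IsSolenoidal G f)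
    (hper : ∀ x ∈ Icc (0 : ℝ) 1, f 1 !₂[x, 1] = f 1 !₂[x, 0]) :
    ∫ x in cellY G, f 0 x = ∫ y in (0 : ℝ)..1, f 0 !₂[1, y] := by
  have h := integral_cellY_gradDot hG hf (ψ := fun ξ => ξ 0)
    (EuclideanSpace.proj (𝕜 := ℝ) (0 : Fin 2)).contDiff
  have h2 : ∫ x in (0 : ℝ)..1, x * f 1 !₂[x, 1] = ∫ x in (0 : ℝ)..1, x * f 1 !₂[x, 0] :=
    intervalIntegral.integral_congr fun x hx => by
      simp only [hper x (by rwa [uIcc_of_le zero_le_one] at hx)]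
  have hd : ∀ x, fderiv ℝ (fun ξ : Plane => ξ 0) x = EuclideanSpace.proj (𝕜 := ℝ) (0 : Fin 2) :=
    fun x => (EuclideanSpace.proj (𝕜 := ℝ) (0 : Fin 2)).fderiv
  have hg : ∀ x, gradDot (fun ξ => ξ 0) f x = f 0 x := by
    intro x
    simp [gradDot, hd]
  simp only [hg] at h
  rw [h]
  simp
  rw [h2]; ring

/-! ### Gradient fields and translations -/

lemma gradient_apply_eq {φ : Plane → ℝ} {x : Plane} (i : Fin 2) :
    ∇ φ x i = fderiv ℝ φ x (EuclideanSpace.single i 1) := by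
  rw [← InnerProductSpace.toDual_symm_apply, ← gradient, EuclideanSpace.inner_single_right]
  simp

lemma clm_apply_eq_sum (L : Plane →L[ℝ] ℝ) (v : Plane) :
    L v = ∑ i, v i * L (EuclideanSpace.single i 1) := by
  have : v = ∑ i, v i • (EuclideanSpace.single i 1 : Plane) := by
    ext j; fin_cases j <;> simp [Fin.sum_univ_two]
  conv_lhs => rw [this]
  simp

/-- If `u + c · ξ` is harmonic in the perforated square with zero normal derivative on the
boundaries of the holes, then its gradient is a solenoidal field. -/
lemma isSolenoidal_gradient {G : Set Plane} (hG : IsRegularHole G) {u : Plane → ℝ} (c : Plane)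
    (hu : ContDiffOn ℝ ∞ u (perfSquare G))
    (hΔ : ∀ x ∈ openSquare, x ∉ closure G → Δ u x = 0)
    (hν : ∀ x ∈ frontier G, ∀ ν, IsUnitNormalInto G x ν →
      fderivWithin ℝ u (perfSquare G) x ν = -∑ i, ν i * c i) :
    IsSolenoidal G fun i x => partialIn (perfSquare G) u i x + c i where
  contDiffOn i := (partialIn_contDiffOn hG.uniqueDiffOn_perfSquare hu (by norm_cast) i).add
    contDiffOn_const
  div_eq_zero x hx hxG := by
    rw [← hΔ x hx hxG, ← sum_partial_partial_eq_laplacian (perfSquare_mem_nhds hx hxG)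
      (hu.of_le (by norm_cast))]
    simp only [planeDiv, fderiv_add_const]
  tangential x φ hφ := by
    have h := hν x hφ.mem_frontier _ ⟨φ, hφ, rfl⟩
    have hn : ‖∇ φ x‖⁻¹ ≠ 0 := inv_ne_zero (norm_ne_zero_iff.2 hφ.gradient_ne)
    rw [map_neg, neg_eq_iff_eq_neg, neg_neg, map_smul, clm_apply_eq_sum] at h
    simp only [gradDot, partialIn, ← gradient_apply_eq, Fin.sum_univ_two, PiLp.neg_apply,
      PiLp.smul_apply, smul_eq_mul] at h ⊢
    refine (mul_eq_zero.1 (?_ : ‖∇ φ x‖⁻¹ * _ = 0)).resolve_left hn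
    linear_combination h

lemma fderivWithin_comp_add_of_mapsTo {S T : Set Plane} {B : Plane → ℝ} {a x : Plane}
    (hB : DifferentiableOn ℝ B T) (hST : ∀ y ∈ S, y + a ∈ T) (hx : x ∈ S)
    (hS : UniqueDiffWithinAt ℝ S x) :
    fderivWithin ℝ (fun y => B (y + a)) S x = fderivWithin ℝ B T (x + a) := by
  have h1 := (hB _ (hST x hx)).hasFDerivWithinAt
  have h2 : HasFDerivWithinAt (fun y : Plane => y + a) (ContinuousLinearMap.id ℝ Plane) S x :=
    (hasFDerivWithinAt_id x S).add_const a
  exact (h1.comp x h2 hST).fderivWithin hS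

lemma fderivWithin_eq_of_subset {S T : Set Plane} {B : Plane → ℝ} {x : Plane}
    (hB : DifferentiableOn ℝ B T) (hST : S ⊆ T) (hx : x ∈ S) (hS : UniqueDiffWithinAt ℝ S x) :
    fderivWithin ℝ B S x = fderivWithin ℝ B T x :=
  fderivWithin_subset hST hS (hB x (hST hx))

/-- The derivative of a periodic function is periodic. -/
lemma fderivWithin_add_period {S T : Set Plane} {B : Plane → ℝ} {a x : Plane}
    (hB : DifferentiableOn ℝ B T) (hST : S ⊆ T) (hST' : ∀ y ∈ S, y + a ∈ T)
    (hper : ∀ y ∈ S, B (y + a) = B y) (hx : x ∈ S) (hxa : x + a ∈ S) (hS : UniqueDiffOn ℝ S) :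
    fderivWithin ℝ B S (x + a) = fderivWithin ℝ B S x := by
  rw [fderivWithin_eq_of_subset hB hST hxa (hS _ hxa),
    ← fderivWithin_comp_add_of_mapsTo hB hST' hx (hS x hx)]
  exact fderivWithin_congr hper (hper x hx)

lemma laplacian_comp_add (u : Plane → ℝ) (a x : Plane) :
    Δ (fun y => u (y + a)) x = Δ u (x + a) := by
  rw [InnerProductSpace.laplacian_eq_iteratedFDeriv_orthonormalBasis _
    (EuclideanSpace.basisFun (Fin 2) ℝ),
    InnerProductSpace.laplacian_eq_iteratedFDeriv_orthonormalBasis _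
    (EuclideanSpace.basisFun (Fin 2) ℝ)]
  simp only [iteratedFDeriv_comp_add_right]

/-! ### Lattice translates and the perforated plane -/

lemma vec_add_period (x : ℝ) : (!₂[x, 0] : Plane) + latticePoint ![0, 1] = !₂[x, 1] := by
  ext i; fin_cases i <;> simp [latticePoint]

lemma vec_add_lattice (x y : ℝ) (n : ℤ) :
    (!₂[x, y] : Plane) + latticePoint ![n, 0] = !₂[x + n, y] := by
  ext i; fin_cases i <;> simp [latticePoint]

lemma latticePoint_zero : latticePoint 0 = 0 := by
  ext i; simp [latticePoint]

lemma latticePoint_add (k l : Fin 2 → ℤ) :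
    latticePoint (k + l) = latticePoint k + latticePoint l := by
  ext i; simp [latticePoint]

lemma perfPlane_add {G : Set Plane} {x : Plane} (hx : x ∈ perfPlane G) (k : Fin 2 → ℤ) :
    x + latticePoint k ∈ perfPlane G := by
  intro l
  have h := hx (l - k)
  have : latticePoint l = latticePoint (l - k) + latticePoint k := by
    rw [← latticePoint_add, sub_add_cancel]
  rwa [this, add_sub_add_right_eq_sub]

lemma perfPlaneInt_add {G : Set Plane} {x : Plane} (hx : x ∈ perfPlaneInt G) (k : Fin 2 → ℤ) :
    x + latticePoint k ∈ perfPlaneInt G := by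
  intro l
  have h := hx (l - k)
  have : latticePoint l = latticePoint (l - k) + latticePoint k := by
    rw [← latticePoint_add, sub_add_cancel]
  rwa [this, add_sub_add_right_eq_sub]

/-- Each coordinate of `k` is an integer strictly between `-1` and `1`. Hence only the untranslated
holes meet the closed unit square. -/
lemma eq_zero_of_sub_mem_openSquare {x : Plane} (hx : x ∈ closedSquare) {k : Fin 2 → ℤ}
    (h : x - latticePoint k ∈ openSquare) : k = 0 := by
  funext i
  have h1 := hx i
  have h2 : 0 < x i - k i ∧ x i - k i < 1 := h i
  have h3 : (k i : ℝ) < 1 := by linarith [h1.2]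
  have h4 : (-1 : ℝ) < k i := by linarith [h1.1]
  have h5 : k i < 1 := by exact_mod_cast h3
  have h6 : -1 < k i := by exact_mod_cast h4
  simp only [Pi.zero_apply]; omega

lemma perfSquare_subset_perfPlane {G : Set Plane} (hG : IsRegularHole G) :
    perfSquare G ⊆ perfPlane G := by
  intro x hx k hk
  have := eq_zero_of_sub_mem_openSquare hx.1 (hG.closure_subset (subset_closure hk))
  rw [this, latticePoint_zero, sub_zero] at hk
  exact hx.2 hk

lemma mem_perfPlaneInt {G : Set Plane} (hG : IsRegularHole G) {x : Plane}
    (hx : x ∈ closedSquare) (hxG : x ∉ closure G) : x ∈ perfPlaneInt G := by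
  intro k hk
  have := eq_zero_of_sub_mem_openSquare hx (hG.closure_subset hk)
  rw [this, latticePoint_zero, sub_zero] at hk
  exact hxG hk

lemma mem_perfSquare_of_notMem_openSquare {G : Set Plane} (hG : IsRegularHole G) {x : Plane}
    (hx : x ∈ closedSquare) (hxo : x ∉ openSquare) : x ∈ perfSquare G :=
  ⟨hx, fun h => hxo (hG.closure_subset (subset_closure h))⟩

lemma left_mem_perfSquare {G : Set Plane} (hG : IsRegularHole G) {t : ℝ} (ht : t ∈ Icc (0 : ℝ) 1) :
    (!₂[0, t] : Plane) ∈ perfSquare G := by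
  refine mem_perfSquare_of_notMem_openSquare hG (fun i => ?_) fun h => ?_
  · fin_cases i
    · simp
    · exact ht
  · simpa using (h 0).1

lemma right_mem_perfSquare {G : Set Plane} (hG : IsRegularHole G) {t : ℝ} (ht : t ∈ Icc (0 : ℝ) 1) :
    (!₂[1, t] : Plane) ∈ perfSquare G := by
  refine mem_perfSquare_of_notMem_openSquare hG (fun i => ?_) fun h => ?_
  · fin_cases i
    · simp
    · exact ht
  · simpa using (h 0).2

lemma bottom_mem_perfSquare {G : Set Plane} (hG : IsRegularHole G) {t : ℝ} (ht : t ∈ Icc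
    (0 : ℝ) 1) :
    (!₂[t, 0] : Plane) ∈ perfSquare G := by
  refine mem_perfSquare_of_notMem_openSquare hG (fun i => ?_) fun h => ?_
  · fin_cases i
    · exact ht
    · simp
  · simpa using (h 1).1

lemma top_mem_perfSquare {G : Set Plane} (hG : IsRegularHole G) {t : ℝ} (ht : t ∈ Icc (0 : ℝ) 1) :
    (!₂[t, 1] : Plane) ∈ perfSquare G := by
  refine mem_perfSquare_of_notMem_openSquare hG (fun i => ?_) fun h => ?_
  · fin_cases i
    · exact ht
    · simp
  · simpa using (h 1).2

lemma intervalIntegrable_left {G : Set Plane} (hG : IsRegularHole G) {f : Plane → ℝ}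
    (hf : ContinuousOn f (perfSquare G)) :
    IntervalIntegrable (fun t => f !₂[0, t]) volume 0 1 := by
  apply ContinuousOn.intervalIntegrable
  rw [uIcc_of_le zero_le_one]
  exact hf.comp (continuous_vec_right 0).continuousOn fun t ht => left_mem_perfSquare hG ht

/-- The flux identity for a periodic function harmonic in a vertical strip. -/
lemma flux_identity_strip {a b : ℝ} (hab : a < b) {Ω : Set Plane} {u : Plane → ℝ}
    (hu : ContDiffOn ℝ ∞ u Ω) (hsub : periodBox a b ⊆ Ω)
    (hsub' : ∀ y ∈ periodBox a b, y + latticePoint ![0, 1] ∈ Ω)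
    (hper : ∀ y ∈ Ω, u (y + latticePoint ![0, 1]) = u y)
    (hΔ : ∀ ξ : Plane, ξ 0 ∈ Ioo a b → ξ 1 ∈ Ioo (0 : ℝ) 1 → Δ u ξ = 0) (c : ℝ) :
    (b - c) * (∫ y in (0 : ℝ)..1, partialIn Ω u 0 !₂[b, y])
      - (a - c) * (∫ y in (0 : ℝ)..1, partialIn Ω u 0 !₂[a, y]) =
    (∫ y in (0 : ℝ)..1, u !₂[b, y]) - ∫ y in (0 : ℝ)..1, u !₂[a, y] := by
  have hS := uniqueDiffOn_periodBox hab
  have hd : DifferentiableOn ℝ u Ω := hu.differentiableOn (by simp)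
  have h := flux_identity_periodBox hab ((hu.mono hsub).of_le (by norm_cast)) hΔ (by
    intro x hx
    have hx0 : (!₂[x, 0] : Plane) ∈ periodBox a b := vertical_mem_periodBox hx (by simp)
    have hx1 : (!₂[x, 1] : Plane) ∈ periodBox a b := vertical_mem_periodBox hx (by simp)
    rw [partialIn, partialIn, ← vec_add_period]
    rw [fderivWithin_add_period hd hsub hsub' (fun y hy => hper y (hsub hy)) hx0
      (by rwa [vec_add_period]) hS]) c
  have hv : ∀ x ∈ Icc a b, ∫ y in (0 : ℝ)..1, partialIn (periodBox a b) u 0 !₂[x, y] =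
      ∫ y in (0 : ℝ)..1, partialIn Ω u 0 !₂[x, y] := by
    intro x hx
    apply intervalIntegral.integral_congr
    intro y hy
    rw [uIcc_of_le zero_le_one] at hy
    have hm := vertical_mem_periodBox hx hy
    simp only [partialIn]
    rw [fderivWithin_eq_of_subset hd hsub hm (hS _ hm)]
  rwa [hv a ⟨le_rfl, hab.le⟩, hv b ⟨hab.le, le_rfl⟩] at h

/-! ### The cell problem: interface flux and homogenized coefficient -/

lemma IsCellSolution.partialIn_eq {G₀ : Set Plane} (hG : IsRegularHole G₀) {N : Plane → ℝ}
    (hN : IsCellSolution G₀ N)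
    {x : Plane} (hx : x ∈ perfSquare G₀) (i : Fin 2) :
    partialIn (perfSquare G₀) N i x = partialIn (perfPlane G₀) N i x := by
  rw [partialIn, partialIn, fderivWithin_eq_of_subset (hN.smooth.differentiableOn (by simp))
    (perfSquare_subset_perfPlane hG) hx (hG.uniqueDiffOn_perfSquare x hx)]

/-- The field is `∇(N₁ + ξ₁)`: the condition `∂_ν N₁ = -ν₁` says exactly that its normal component
vanishes. -/
lemma IsCellSolution.isSolenoidal {G₀ : Set Plane} (hG : IsRegularHole G₀) {N : Plane → ℝ}
    (hN : IsCellSolution G₀ N) :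
    IsSolenoidal G₀ fun i x =>
    partialIn (perfSquare G₀) N i x + (EuclideanSpace.single 0 1 : Plane) i := by
  refine isSolenoidal_gradient hG _ (hN.smooth.mono (perfSquare_subset_perfPlane hG))
    (fun x hx hxG => hN.laplace x (mem_perfPlaneInt hG (openSquare_subset hx) hxG)) ?_
  intro x hx ν hν
  have hxS : x ∈ perfSquare G₀ := by
    rw [hG.isOpen.frontier_eq] at hx
    exact ⟨openSquare_subset (hG.closure_subset hx.1), hx.2⟩
  rw [fderivWithin_eq_of_subset (hN.smooth.differentiableOn (by simp))
    (perfSquare_subset_perfPlane hG) hxS (hG.uniqueDiffOn_perfSquare x hxS), hN.neumann x hx ν hν]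
  simp

theorem IsCellSolution.interfaceFlux_eq {G₀ : Set Plane} (hG : IsRegularHole G₀) {N : Plane → ℝ}
    (hN : IsCellSolution G₀ N) :
    interfaceFlux G₀ N = volume.real (cellY G₀) * h11 G₀ N := by
  have hs := hN.isSolenoidal hG
  have hper : ∀ x ∈ Icc (0 : ℝ) 1, partialIn (perfSquare G₀) N 1 !₂[x, 1] =
      partialIn (perfSquare G₀) N 1 !₂[x, 0] := by
    intro x hx
    have h0 := bottom_mem_perfSquare hG hx
    have h1 := top_mem_perfSquare hG hx
    rw [partialIn, partialIn, ← vec_add_period]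
    have hsub := perfSquare_subset_perfPlane hG
    rw [fderivWithin_add_period (hN.smooth.differentiableOn (by simp)) hsub
      (fun y hy => perfPlane_add (hsub hy) _) (fun y hy => hN.periodic _ y (hsub hy)) h0
      (by rwa [vec_add_period]) hG.uniqueDiffOn_perfSquare]
  have h1 := integral_cellY_eq_flux hG hs (fun x hx => by simp only [hper x hx])
  rw [flux_left_eq_flux_right hG hs (fun x hx => by simp only [hper x hx])] at h1
  have hfin : volume (cellY G₀) ≠ ⊤ :=
    measure_ne_top_of_subset sdiff_subset isCompact_closedSquare.measure_ne_top
  rw [h11, ← smul_eq_mul, measure_smul_setAverage _ hfin]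
  have e1 : interfaceFlux G₀ N = ∫ y in (0 : ℝ)..1, (partialIn (perfSquare G₀) N 0 !₂[0, y] +
      (EuclideanSpace.single 0 1 : Plane) 0) := by
    apply intervalIntegral.integral_congr
    intro y hy
    rw [uIcc_of_le zero_le_one] at hy
    simp [hN.partialIn_eq hG (left_mem_perfSquare hG hy)]
  rw [e1, ← h1]
  refine setIntegral_congr_fun (measurableSet_cellY G₀) fun x hx => ?_
  simp [hN.partialIn_eq hG (cellY_subset G₀ hx), add_comm]

/-! ### The inner layer: vanishing fluxes and the value of the flux constant -/

lemma norm_vertical_integral_le {u : Plane → ℝ} {x ε : ℝ}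
    (h : ∀ y ∈ Icc (0 : ℝ) 1, |u !₂[x, y]| ≤ ε) : |∫ y in (0 : ℝ)..1, u !₂[x, y]| ≤ ε := by
  have := intervalIntegral.norm_integral_le_of_norm_le_const (a := (0 : ℝ)) (b := 1) (C := ε)
    (f := fun y => u !₂[x, y]) (by
      intro y hy
      rw [uIoc_of_le zero_le_one] at hy
      exact h y (Ioc_subset_Icc_self hy))
  simpa using this

lemma leftHalf_contains_periodBox (M : ℝ) : periodBox (-M) 0 ⊆ leftHalf := fun _ h => h.1.2

lemma leftHalf_add {y : Plane} (hy : y ∈ leftHalf) : y + latticePoint ![0, 1] ∈ leftHalf := by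
  simpa [leftHalf, latticePoint] using hy

lemma rightHalf_add {G : Set Plane} {y : Plane} (hy : y ∈ rightHalf G) {k : Fin 2 → ℤ}
    (hk : 0 ≤ k 0) : y + latticePoint k ∈ rightHalf G := by
  refine ⟨?_, perfPlane_add hy.2 k⟩
  have h1 : (0 : ℝ) ≤ k 0 := by exact_mod_cast hk
  have h2 := hy.1
  simp only [latticePoint, PiLp.add_apply]
  linarith

lemma perfSquare_subset_rightHalf {G : Set Plane} (hG : IsRegularHole G) :
    perfSquare G ⊆ rightHalf G :=
  fun _ hx => ⟨(hx.1 0).1, perfSquare_subset_perfPlane hG hx⟩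

/-- The flux of the left layer function through the interface vanishes. -/
lemma IsInnerLayerSolution.flux_left {G₀ : Set Plane} {N : Plane → ℝ} {J q : ℝ}
    {Bm Bp : Plane → ℝ} (hB : IsInnerLayerSolution G₀ N J q Bm Bp) :
    ∫ y in (0 : ℝ)..1, partialIn leftHalf Bm 0 !₂[0, y] = 0 := by
  obtain ⟨M₀, hM₀⟩ := hB.decay_left 1 one_pos
  by_contra hne
  set Φ := ∫ y in (0 : ℝ)..1, partialIn leftHalf Bm 0 !₂[0, y] with hΦ
  set A := ∫ y in (0 : ℝ)..1, Bm !₂[0, y] with hA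
  have hpos : 0 < |Φ| := abs_pos.2 hne
  -- Far enough that `|Bm| ≤ 1` on the line `ξ₁ = -M`, and wide enough that `M * |Φ|` exceeds `|A| +
  -- 1`, the largest possible difference of the means.
  set M := max (max M₀ 1) ((|A| + 2) / |Φ|) with hM
  have hM1 : 1 ≤ M := (le_max_right _ _).trans (le_max_left _ _)
  have hM2 : M₀ ≤ M := (le_max_left _ _).trans (le_max_left _ _)
  have hM3 : |A| + 2 ≤ M * |Φ| := (div_le_iff₀ hpos).1 (le_max_right _ _)
  -- The choice `c = -M` removes the flux through the far side, about which nothing is known.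
  have h := flux_identity_strip (a := -M) (b := 0) (by linarith) hB.smooth_left
    (leftHalf_contains_periodBox M)
    (fun y hy => leftHalf_add (leftHalf_contains_periodBox M hy)) hB.periodic_left
    (fun ξ h0 _ => hB.laplace_left ξ h0.2) (-M)
  have hb : |∫ y in (0 : ℝ)..1, Bm !₂[-M, y]| ≤ 1 := by
    refine norm_vertical_integral_le fun y _ => (hM₀ _ ?_ ?_).le
    · change -M ≤ 0; linarith
    · change -M ≤ -M₀; linarith
  rw [sub_self, zero_mul, sub_zero, sub_neg_eq_add, zero_add, ← hΦ, ← hA] at h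
  have h2 : M * |Φ| = |A - ∫ y in (0 : ℝ)..1, Bm !₂[-M, y]| := by
    rw [← h, abs_mul, abs_of_nonneg (by linarith : (0 : ℝ) ≤ M)]
  have h3 := abs_sub A (∫ y in (0 : ℝ)..1, Bm !₂[-M, y])
  linarith

/-- The flux of the right layer function is the same through all lines `ξ₁ = n`. -/
lemma IsInnerLayerSolution.flux_right_eq {G₀ : Set Plane} (hG : IsRegularHole G₀) {N : Plane → ℝ}
    {J q : ℝ} {Bm Bp : Plane → ℝ} (hB : IsInnerLayerSolution G₀ N J q Bm Bp)
    (n : ℕ) :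
    ∫ y in (0 : ℝ)..1, partialIn (rightHalf G₀) Bp 0 !₂[(n : ℝ), y] =
      ∫ y in (0 : ℝ)..1, partialIn (rightHalf G₀) Bp 0 !₂[0, y] := by
  induction n with
  | zero => simp
  | succ n ih =>
    rw [← ih]
    -- The cell between `ξ₁ = n` and `ξ₁ = n + 1` is translated to the unit square, where the
    -- gradient of the shifted function is solenoidal with `c = 0`.
    set a := latticePoint ![(n : ℤ), 0] with ha
    have hd : DifferentiableOn ℝ Bp (rightHalf G₀) := hB.smooth_right.differentiableOn (by simp)
    have hmaps : ∀ y ∈ perfSquare G₀, y + a ∈ rightHalf G₀ := fun y hy =>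
      rightHalf_add (perfSquare_subset_rightHalf hG hy) (by simp)
    have hS := hG.uniqueDiffOn_perfSquare
    have hshift : ∀ x ∈ perfSquare G₀, fderivWithin ℝ (fun y => Bp (y + a)) (perfSquare G₀) x =
        fderivWithin ℝ Bp (rightHalf G₀) (x + a) := fun x hx =>
      fderivWithin_comp_add_of_mapsTo hd hmaps hx (hS x hx)
    have hsm : ContDiffOn ℝ ∞ (fun y => Bp (y + a)) (perfSquare G₀) :=
      hB.smooth_right.comp (contDiff_id.add contDiff_const).contDiffOn hmaps
    have hs := isSolenoidal_gradient hG (u := fun y => Bp (y + a)) 0 hsm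
      (by
        intro x hx hxG
        rw [laplacian_comp_add]
        apply hB.laplace_right _ (perfPlaneInt_add (mem_perfPlaneInt hG (openSquare_subset hx) hxG)
          _)
        have := (hx 0).1
        have hn : (0 : ℝ) ≤ n := n.cast_nonneg
        change 0 < x 0 + ((n : ℤ) : ℝ)
        push_cast
        linarith)
      (by
        intro x hx ν hν
        have hxS : x ∈ perfSquare G₀ := by
          rw [hG.isOpen.frontier_eq] at hx
          exact ⟨openSquare_subset (hG.closure_subset hx.1), hx.2⟩
        rw [hshift x hxS, hB.neumann _ (by simp) x hx ν hν]
        simp)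
    have key := flux_left_eq_flux_right hG hs (by
      intro x hx
      have h0 := bottom_mem_perfSquare hG hx
      have h1 := top_mem_perfSquare hG hx
      -- The vertical period moves the unit square out of itself, so differentiability is needed on
      -- the larger translated half-plane.
      have hT : DifferentiableOn ℝ (fun y => Bp (y + a)) {y | y + a ∈ rightHalf G₀} :=
        hd.comp (differentiable_id.add_const a).differentiableOn fun _ hy => hy
      simp only [partialIn]
      rw [← vec_add_period, fderivWithin_add_period hT hmaps
        (fun y hy => by
          rw [mem_ofPred_eq, add_right_comm]
          exact rightHalf_add (hmaps y hy) (by simp))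
        (fun y hy => by rw [add_right_comm]; exact hB.periodic_right _ (hmaps y hy)) h0
        (by rwa [vec_add_period]) hS])
    have e1 : ∀ y ∈ Icc (0 : ℝ) 1, partialIn (perfSquare G₀) (fun y => Bp (y + a)) 0 !₂[1, y] =
        partialIn (rightHalf G₀) Bp 0 !₂[((n + 1 : ℕ) : ℝ), y] := by
      intro y hy
      rw [partialIn, partialIn, hshift _ (right_mem_perfSquare hG hy), vec_add_lattice]
      push_cast
      rw [add_comm (1 : ℝ)]
    have e0 : ∀ y ∈ Icc (0 : ℝ) 1, partialIn (perfSquare G₀) (fun y => Bp (y + a)) 0 !₂[0, y] =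
        partialIn (rightHalf G₀) Bp 0 !₂[(n : ℝ), y] := by
      intro y hy
      rw [partialIn, partialIn, hshift _ (left_mem_perfSquare hG hy), vec_add_lattice]
      push_cast
      rw [zero_add]
    rw [← uIcc_of_le zero_le_one] at e0 e1
    rw [← intervalIntegral.integral_congr e0, ← intervalIntegral.integral_congr e1]
    simpa using key

/-- The flux of the right layer function through the interface vanishes. -/
lemma IsInnerLayerSolution.flux_right {G₀ : Set Plane} (hG : IsRegularHole G₀) {N : Plane → ℝ}
    {J q : ℝ} {Bm Bp : Plane → ℝ} (hB : IsInnerLayerSolution G₀ N J q Bm Bp) :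
    ∫ y in (0 : ℝ)..1, partialIn (rightHalf G₀) Bp 0 !₂[0, y] = 0 := by
  -- By compactness the closures of the holes keep a positive distance from `ξ₁ = 0`; halving it
  -- makes the inequality strict.
  obtain ⟨δ', hδ'0, hδ'⟩ := (isCompact_closedSquare.of_isClosed_subset isClosed_closure
    (hG.closure_subset.trans openSquare_subset)).exists_forall_le' (f := fun x : Plane => x 0)
    (EuclideanSpace.proj (𝕜 := ℝ) (0 : Fin 2)).continuous.continuousOn (a := 0)
    (fun x hx => (hG.closure_subset hx 0).1)
  set δ := δ' / 2
  have hδ : 0 < δ := by positivity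
  have hδc : ∀ x ∈ closure G₀, δ < x 0 := fun x hx => (half_lt_self hδ'0).trans_le (hδ' x hx)
  set Φ := ∫ y in (0 : ℝ)..1, partialIn (rightHalf G₀) Bp 0 !₂[0, y] with hΦ
  have hbd : ∀ ε > 0, δ * |Φ| ≤ 0 + ε := by
    intro ε hε
    obtain ⟨M, hM⟩ := hB.decay_right (ε / 2) (half_pos hε)
    obtain ⟨n, hn⟩ := exists_nat_ge M
    have hn0 : (0 : ℝ) ≤ n := n.cast_nonneg
    -- A translate by `k` meeting this strip would need `n - 1 < k 0 < n`.
    have hint : ∀ ξ : Plane, ξ 0 ∈ Icc (n : ℝ) (n + δ) → ξ ∈ perfPlaneInt G₀ := by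
      intro ξ hξ k hk
      have h1 : δ < ξ 0 - k 0 := hδc _ hk
      have h2 : ξ 0 - k 0 < 1 := (hG.closure_subset hk 0).2
      have h3 : ((k 0 : ℤ) : ℝ) < (n : ℤ) := by push_cast; linarith [hξ.2]
      have h4 : (((n : ℤ) - 1 : ℤ) : ℝ) < (k 0 : ℤ) := by push_cast; linarith [hξ.1]
      have h5 : k 0 < (n : ℤ) := by exact_mod_cast h3
      have h6 : (n : ℤ) - 1 < k 0 := by exact_mod_cast h4
      omega
    have hsub : periodBox (n : ℝ) (n + δ) ⊆ rightHalf G₀ := fun ξ hξ =>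
      ⟨hn0.trans hξ.1.1, fun k hk => hint ξ hξ.1 k (subset_closure hk)⟩
    -- With `c = n + δ` only the flux through `ξ₁ = n` remains, and it equals `Φ`. Hence `δ * Φ` is
    -- a difference of two means, each at most `ε / 2` in absolute value.
    have h := flux_identity_strip (a := (n : ℝ)) (b := n + δ) (by linarith) hB.smooth_right hsub
      (fun y hy => rightHalf_add (hsub hy) (by simp)) hB.periodic_right
      (fun ξ h0 _ => hB.laplace_right ξ (hint ξ (Ioo_subset_Icc_self h0)) (hn0.trans_lt h0.1))
      (n + δ)
    rw [hB.flux_right_eq hG n, sub_self, zero_mul, ← hΦ] at h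
    have hb : ∀ x ∈ Icc (n : ℝ) (n + δ), |∫ y in (0 : ℝ)..1, Bp !₂[x, y]| ≤ ε / 2 := by
      intro _ hx
      refine norm_vertical_integral_le fun y hy =>
        (hM _ (hsub (vertical_mem_periodBox hx hy)) ?_).le
      exact hn.trans hx.1
    have h1 := hb n ⟨le_rfl, by linarith⟩
    have h2 := hb (n + δ) ⟨by linarith, le_rfl⟩
    have h3 : δ * |Φ| = |(∫ y in (0 : ℝ)..1, Bp !₂[(n : ℝ) + δ, y]) -
        ∫ y in (0 : ℝ)..1, Bp !₂[(n : ℝ), y]| := by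
      rw [← h, ← abs_of_pos hδ, ← abs_mul, abs_of_pos hδ]
      congr 1; ring
    rw [h3]
    have h4 := abs_sub (∫ y in (0 : ℝ)..1, Bp !₂[(n : ℝ) + δ, y])
      (∫ y in (0 : ℝ)..1, Bp !₂[(n : ℝ), y])
    linarith
  have h0 := le_of_forall_pos_le_add hbd
  have : |Φ| ≤ 0 := by nlinarith
  exact abs_nonpos_iff.1 this

theorem IsInnerLayerSolution.flux_eq {G₀ : Set Plane} (hG : IsRegularHole G₀) {N : Plane → ℝ}
    {J q : ℝ} {Bm Bp : Plane → ℝ} (hB : IsInnerLayerSolution G₀ N J q Bm Bp)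
    (hN : IsCellSolution G₀ N) : J = interfaceFlux G₀ N := by
  have hS := hG.uniqueDiffOn_perfSquare
  have hright : IntervalIntegrable (fun t => partialIn (rightHalf G₀) Bp 0 !₂[0, t]) volume 0 1 :=
    by
    have hsub := perfSquare_subset_rightHalf hG
    refine IntervalIntegrable.congr ?_ (intervalIntegrable_left hG (partialIn_contDiffOn (m := 0) hS
      (hB.smooth_right.mono hsub) (by simp) 0).continuousOn)
    intro t ht
    rw [uIoc_of_le zero_le_one] at ht
    have hm := left_mem_perfSquare hG (Ioc_subset_Icc_self ht)
    simp only [partialIn]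
    rw [fderivWithin_eq_of_subset (hB.smooth_right.differentiableOn (by simp)) hsub hm (hS _ hm)]
  have hleft : IntervalIntegrable (fun t => partialIn leftHalf Bm 0 !₂[0, t]) volume 0 1 := by
    have hsub := leftHalf_contains_periodBox 1
    have hu := uniqueDiffOn_periodBox (a := -1) (b := 0) (by norm_num)
    refine IntervalIntegrable.congr ?_ (intervalIntegrable_vertical (a := -1) (b := 0) (x := 0)
      (by simp) (partialIn_contDiffOn (m := 0) hu
      (hB.smooth_left.mono hsub) (by simp) 0).continuousOn)
    intro t ht
    rw [uIoc_of_le zero_le_one] at ht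
    have hm : (!₂[0, t] : Plane) ∈ periodBox (-1) 0 :=
      vertical_mem_periodBox (by simp) (Ioc_subset_Icc_self ht)
    simp only [partialIn]
    rw [fderivWithin_eq_of_subset (hB.smooth_left.differentiableOn (by simp)) hsub hm (hu _ hm)]
  have hcell : IntervalIntegrable (fun t => partialIn (perfPlane G₀) N 0 !₂[0, t] + 1)
      volume 0 1 := by
    refine IntervalIntegrable.congr ?_ (intervalIntegrable_left hG
      ((hN.isSolenoidal hG).contDiffOn 0).continuousOn)
    intro t ht
    rw [uIoc_of_le zero_le_one] at ht
    simp [hN.partialIn_eq hG (left_mem_perfSquare hG (Ioc_subset_Icc_self ht))]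
  -- The derivative jump is prescribed only for `0 < t < 1`; the endpoints do not affect the
  -- integral.
  have hae : ∫ t in (0 : ℝ)..1, (partialIn (rightHalf G₀) Bp 0 !₂[0, t] -
      partialIn leftHalf Bm 0 !₂[0, t] + (partialIn (perfPlane G₀) N 0 !₂[0, t] + 1)) =
      ∫ _ in (0 : ℝ)..1, J := by
    apply intervalIntegral.integral_congr_Ioo_of_le zero_le_one
    intro t ht
    simp only [hB.jump_deriv t ht]
    ring
  rw [intervalIntegral.integral_add (hright.sub hleft) hcell,
    intervalIntegral.integral_sub hright hleft, hB.flux_left, hB.flux_right hG] at hae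
  simp only [intervalIntegral.integral_const] at hae
  simp at hae
  rw [interfaceFlux, ← hae]

end

theorem proposition3p5 (G₀ : Set Plane) (hG₀ : IsHoleSet G₀)
    (N₁ : Plane → ℝ) (hN₁ : IsCellSolution G₀ N₁) :
    (∀ J : ℝ, IsFluxConstant G₀ N₁ J → J = interfaceFlux G₀ N₁) ∧
    interfaceFlux G₀ N₁ = volume.real (cellY G₀) * h11 G₀ N₁ ∧
    (∀ d : ℝ, 0 < d → ∀ vm vp : Plane → ℝ,
      (TransmissionCondition d (interfaceFlux G₀ N₁) vm vp ↔
        TransmissionCondition d (volume.real (cellY G₀) * h11 G₀ N₁) vm vp)) := by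
  have hG := hG₀.isRegularHole
  have h := hN₁.interfaceFlux_eq hG
  refine ⟨?_, h, fun d _ vm vp => by rw [h]⟩
  rintro J ⟨q, Bm, Bp, hB⟩
  exact hB.flux_eq hG hN₁
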